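/- Let $n\in\mathbb N$, let $\mathbf D\subset\mathbb R^n$ be compact with $0\in\mathbf D$, and let $C(\mathbf D)$ be the space of real continuous functions on $\mathbf D$ with the supremum norm. For $u>0$ let $\xi_u=\{\xi_u(t),t\in\mathbf D\}$ be a centered Gaussian random field with a.s. continuous sample paths and standard deviation function $\sigma_{\xi_u}$. Assume: **C1.** $\sigma_{\xi_u}(0)=1$ for all large $u$, and there is a bounded measurable function $d:\mathbf D\to\mathbb R$ with $\lim_{u\to\infty}\sup_{t\in\mathbf D}\left|u^2(1-\sigma_{\xi_u}(t))-d(t)\right|=0$. **C2.** There is a centered Gaussian random field $\{\eta(t),t\in\mathbb R^n\}$ with a.s. continuous sample paths, $\eta(0)=0$ a.s., such that $\lim_{u\to\infty}u^2\,\mathrm{Var}(\xi_u(t)-\xi_u(s))=2\,\mathrm{Var}(\eta(t)-\eta(s))$ for all $t,s\in\mathbf D$. **C3.** There are constants $G,\nu,u_0>0$ such that $u^2\,\mathrm{Var}(\xi_u(t)-\xi_u(s))\le G\|t-s\|^\nu$ for all $u>u_0$ and all $t,s\in\mathbf D$, where $\|\cdot\|$ is the Euclidean norm. Let $F:C(\mathbf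 D)\to\mathbb R$ be continuous with $|F(f)|\le\sup_{t\in\mathbf D}|f(t)|$ and $F(cf+b)=cF(f)+b$ for all $f\in C(\mathbf D)$, $c>0$, $b\in\mathbb R$. Let $g:(0,\infty)\to(0,\infty)$ be measurable with $\lim_{u\to\infty}g(u)/u=a\in(0,\infty)$. Put $$\mathcal H^F_{a\eta,a^2d}(\mathbf D)=\mathbb E\left[\exp\left(F\left(\sqrt2\,a\,\eta(\cdot)-a^2\,\mathrm{Var}(\eta(\cdot))-a^2d(\cdot)\right)\right)\right],$$ and let $\Psi$ be the tail distribution function of a standard normal random variable. Then $\mathcal H^F_{a\eta,a^2d}(\mathbf D)\in(0,\infty)$ and $$\mathbb P\left(F(\xi_u)>g(u)\right)=\mathcal H^F_{a\eta,a^2d}(\mathbf D)\,\Psi(g(u))\,(1+o(1)),\qquad u\to\infty .$$ -/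

import Mathlib

open MeasureTheory ProbabilityTheory Filter Topology Asymptotics

namespace GaussianField

/-- A centered Gaussian random field `X` indexed by `T` with almost surely continuous sample
paths, on the probability space `(Ω, P)`. -/
structure IsCenteredContinuous {T Ω : Type*} [TopologicalSpace T] [MeasurableSpace Ω]
    (X : T → Ω → ℝ) (P : Measure Ω) : Prop where
  gaussian : IsGaussianProcess X P
  centered : ∀ t, ∫ ω, X t ω ∂P = 0
  continuous_paths : ∀ᵐ ω ∂P, Continuous fun t => X t ω

/-- The standard deviation function of the field `X`. -/
noncomputable def stdDev {T Ω : Type*} [MeasurableSpace Ω]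
    (X : T → Ω → ℝ) (P : Measure Ω) (t : T) : ℝ :=
  Real.sqrt (Var[X t; P])

/-- The value of the functional `F` on `C(T, ℝ)` at a path `f`. Paths are continuous only almost
surely; on the exceptional (discontinuous) paths the value is set to `0`. -/
noncomputable def pathEval {T : Type*} [TopologicalSpace T] (F : C(T, ℝ) → ℝ) (f : T → ℝ) : ℝ :=
  open Classical in if h : Continuous f then F ⟨f, h⟩ else 0

theorem pathEval_coe {T : Type*} [TopologicalSpace T] (F : C(T, ℝ) → ℝ) (f : C(T, ℝ)) :
    pathEval F f = F f := by
  exact dif_pos f.continuous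

/-- The random variable `exp (F (√2 η(t) - Var η(t) - d(t)))`. -/
noncomputable def expFunctional {T Ω : Type*} [TopologicalSpace T] [MeasurableSpace Ω]
    (F : C(T, ℝ) → ℝ) (η : T → Ω → ℝ) (d : T → ℝ) (Q : Measure Ω) (ω : Ω) : ℝ :=
  Real.exp (pathEval F fun t => Real.sqrt 2 * η t ω - Var[η t; Q] - d t)

/-- The generalized Piterbarg constant `E exp (F (√2 η(t) - Var η(t) - d(t)))`. -/
noncomputable def piterbargConst {T Ω : Type*} [TopologicalSpace T] [MeasurableSpace Ω]
    (F : C(T, ℝ) → ℝ) (η : T → Ω → ℝ) (d : T → ℝ) (Q : Measure Ω) : ℝ :=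
  ∫ ω, expFunctional F η d Q ω ∂Q

/-- The tail distribution function of a standard normal random variable. -/
noncomputable def normalTail (x : ℝ) : ℝ :=
  (gaussianReal 0 1).real (Set.Ioi x)

end GaussianField

set_option linter.unusedSectionVars false

/-! Near a high level `g`, the event is governed by the value `N` of the field at the base point, a
standard normal variable, taken within order 1/g of `g`; relative to `N` the field varies only by
order 1/g. Write X = r N + Z/g, where r(t) = cov(X(t), N) and Z is a Gaussian field independent of
`N`. Substitute N = g - y/g. The normal density φ becomes φ(g) exp(y - y²/(2g²)), and with m = g²(r
- 1) the rule F(cf + b) = cF(f) + b turns F(X) > g into F(m - (y/g²)m + Z) > y. Hence P(F(X) > g)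
equals φ(g)/g times the integral over `y` of exp(y - y²/(2g²)) P(F(m - (y/g²)m + Z) > y); this is
`measureReal_lt_pathEval_eq_rescaled`. Put ζ = aη and δ = a²d. Then `m` converges uniformly to -Var
ζ - δ (`exists_tendsto_drift`) and `Z` converges in law in the path space to √2 ζ
(`tendstoInDistribution_residual`). The integral therefore tends to the integral of e^y P(F(√2 ζ -
Var ζ - δ) > y), which is the Piterbarg constant (`integral_exp_mul_tail`). The same substitution
gives Ψ(g) ~ φ(g)/g. Condition C3 supplies the uniformity. Chaining over dyadic nets yields
stochastic equicontinuity, hence the upgrade from finite-dimensional convergence to paths, and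
exponential tails of every rate for sup |Z|, hence the domination of e^y (`exists_measureReal_le`).
-/

namespace GaussianField

/-! ### Deterministic chaining over dyadic nets -/

/-- Nets at all dyadic scales, with cardinality growing at most exponentially in the level. The
map `proj k` sends a point to a nearby point of the `k`-th net, and the net of level `0`
is the base point. -/
structure DyadicNets (T : Type*) [PseudoMetricSpace T] (t₀ : T) where
  proj : ℕ → T → T
  growth : ℝ
  scale : ℝ
  growth_nonneg : 0 ≤ growth
  scale_pos : 0 < scale
  proj_zero : ∀ t, proj 0 t = t₀
  finite_range : ∀ k, (Set.range (proj k)).Finite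
  ncard_le : ∀ k, ((Set.range (proj k)).ncard : ℝ) ≤ growth ^ k
  dist_proj_le : ∀ k t, dist (proj k t) t ≤ scale * (1 / 2) ^ k

namespace DyadicNets

variable {T : Type*} [PseudoMetricSpace T] {t₀ : T} (N : DyadicNets T t₀)

/-- Pairs of neighbouring net points of level `k`. -/
def pairs (k : ℕ) : Set (T × T) :=
  {p | p.1 ∈ Set.range (N.proj k) ∧ p.2 ∈ Set.range (N.proj k) ∪ Set.range (N.proj (k + 1)) ∧
    dist p.1 p.2 ≤ 4 * N.scale * (1 / 2) ^ k}

theorem pairs_subset (k : ℕ) : N.pairs k ⊆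
    Set.range (N.proj k) ×ˢ (Set.range (N.proj k) ∪ Set.range (N.proj (k + 1))) :=
  fun _ h => ⟨h.1, h.2.1⟩

theorem finite_pairs (k : ℕ) : (N.pairs k).Finite :=
  ((N.finite_range k).prod ((N.finite_range k).union (N.finite_range (k + 1)))).subset
    (N.pairs_subset k)

theorem ncard_pairs_le (k : ℕ) :
    ((N.pairs k).ncard : ℝ) ≤ (1 + N.growth) * (N.growth ^ 2) ^ k := by
  have h1 := Set.ncard_le_ncard (N.pairs_subset k)
    ((N.finite_range k).prod ((N.finite_range k).union (N.finite_range (k + 1))))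
  rw [Set.ncard_prod] at h1
  have h2 := Set.ncard_union_le (Set.range (N.proj k)) (Set.range (N.proj (k + 1)))
  have h3 : ((N.pairs k).ncard : ℝ) ≤ (Set.range (N.proj k)).ncard *
      ((Set.range (N.proj k)).ncard + (Set.range (N.proj (k + 1))).ncard) := by
    exact_mod_cast h1.trans (Nat.mul_le_mul_left _ h2)
  have hg := N.growth_nonneg
  calc ((N.pairs k).ncard : ℝ) ≤ N.growth ^ k * (N.growth ^ k + N.growth ^ (k + 1)) := by
        refine h3.trans ?_
        gcongr
        · exact N.ncard_le k
        · exact N.ncard_le k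
        · exact N.ncard_le (k + 1)
    _ = _ := by ring

/-- Along the net points `f` has increments at level `k` bounded by `b k`. -/
def Controls (b : ℕ → ℝ) (f : T → ℝ) : Prop :=
  ∀ k, ∀ p ∈ N.pairs k, |f p.1 - f p.2| ≤ b k

theorem tendsto_proj (t : T) : Tendsto (fun k => N.proj k t) atTop (𝓝 t) := by
  rw [tendsto_iff_dist_tendsto_zero]
  refine squeeze_zero (fun _ => dist_nonneg) (fun k => N.dist_proj_le k t) ?_
  simpa using (tendsto_pow_atTop_nhds_zero_of_lt_one (r := (1 / 2 : ℝ)) (by norm_num)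
    (by norm_num)).const_mul N.scale

theorem proj_succ_mem_pairs (k : ℕ) (t : T) : (N.proj k t, N.proj (k + 1) t) ∈ N.pairs k := by
  refine ⟨⟨t, rfl⟩, Or.inr ⟨t, rfl⟩, ?_⟩
  have h1 := N.dist_proj_le k t
  have h2 := N.dist_proj_le (k + 1) t
  have h3 := dist_triangle_right (N.proj k t) (N.proj (k + 1) t) t
  have h4 : 0 < N.scale * (1 / 2) ^ k := mul_pos N.scale_pos (by positivity)
  rw [pow_succ] at h2
  simp only
  linarith

variable {N}

/-- The increments telescope along the projections of `t` from level `K` on; continuity of `f`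
closes the chain at `t` itself. -/
theorem Controls.abs_sub_proj_le {b : ℕ → ℝ} {f : T → ℝ} (h : N.Controls b f)
    (hb : Summable b) (hb0 : ∀ k, 0 ≤ b k) (hf : Continuous f) (K : ℕ) (t : T) :
    |f t - f (N.proj K t)| ≤ ∑' k, b (k + K) := by
  have hs : Summable fun k => b (k + K) := (summable_nat_add_iff K).2 hb
  have key : ∀ n, |f (N.proj (n + K) t) - f (N.proj K t)| ≤ ∑ k ∈ Finset.range n, b (k + K) := by
    intro n
    induction n with
    | zero => simp
    | succ n ih =>
      rw [Finset.sum_range_succ]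
      have h1 := h (n + K) _ (N.proj_succ_mem_pairs (n + K) t)
      simp only at h1
      rw [abs_sub_comm] at h1
      have h2 := abs_sub_le (f (N.proj (n + K + 1) t)) (f (N.proj (n + K) t)) (f (N.proj K t))
      rw [show n + 1 + K = n + K + 1 by ring]
      linarith
  have lim : Tendsto (fun n => |f (N.proj (n + K) t) - f (N.proj K t)|) atTop
      (𝓝 |f t - f (N.proj K t)|) := by
    have := (hf.tendsto t).comp ((tendsto_add_atTop_iff_nat K).2 (N.tendsto_proj t))
    exact (this.sub_const _).abs
  refine le_of_tendsto' lim fun n => (key n).trans ?_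
  exact hs.sum_le_tsum _ fun k _ => hb0 _

theorem Controls.abs_sub_base_le {b : ℕ → ℝ} {f : T → ℝ} (h : N.Controls b f)
    (hb : Summable b) (hb0 : ∀ k, 0 ≤ b k) (hf : Continuous f) (t : T) :
    |f t - f t₀| ≤ ∑' k, b k := by
  simpa [N.proj_zero] using h.abs_sub_proj_le hb hb0 hf 0 t

/-- The path from `s` to `t` goes down to the net, across and back up. The projections of two points
this close are still neighbours at level `K`, so each of the three legs costs at most the tail sum.
-/
theorem Controls.abs_sub_le {b : ℕ → ℝ} {f : T → ℝ} (h : N.Controls b f)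
    (hb : Summable b) (hb0 : ∀ k, 0 ≤ b k) (hf : Continuous f) (K : ℕ) {s t : T}
    (hst : dist s t ≤ N.scale * (1 / 2) ^ K) :
    |f s - f t| ≤ 3 * ∑' k, b (k + K) := by
  have hs : Summable fun k => b (k + K) := (summable_nat_add_iff K).2 hb
  have h1 := h.abs_sub_proj_le hb hb0 hf K s
  have h2 := h.abs_sub_proj_le hb hb0 hf K t
  have h3 : |f (N.proj K s) - f (N.proj K t)| ≤ b K := by
    refine h K (N.proj K s, N.proj K t) ⟨⟨s, rfl⟩, Or.inl ⟨t, rfl⟩, ?_⟩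
    have e1 := N.dist_proj_le K s
    have e2 := N.dist_proj_le K t
    have e3 := dist_triangle4_right (N.proj K s) (N.proj K t) s t
    have h4 : 0 < N.scale * (1 / 2) ^ K := mul_pos N.scale_pos (by positivity)
    simp only
    linarith
  have h4 : b K ≤ ∑' k, b (k + K) := by
    simpa using hs.le_tsum 0 fun k _ => hb0 _
  rw [abs_le] at *
  constructor <;> linarith [h1.1, h1.2, h2.1, h2.2, h3.1, h3.2]

end DyadicNets

/-! ### Uniform tail and modulus bounds for Gaussian fields -/

/-- A centered continuous Gaussian field whose increments have variance at most
`κ * dist s t ^ ν`. -/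
structure IsHolderGaussian {T Ω : Type*} [PseudoMetricSpace T] [MeasurableSpace Ω]
    (X : T → Ω → ℝ) (P : Measure Ω) (κ ν : ℝ) : Prop extends IsCenteredContinuous X P where
  variance_sub_le : ∀ s t, Var[fun ω => X s ω - X t ω; P] ≤ κ * dist s t ^ ν

/-- Chernoff's bound for `Y` and `-Y`. The parameter `l` is left free so that each chaining level
can use its own. -/
theorem measure_lt_abs_le_of_hasGaussianLaw {Ω : Type*} [MeasurableSpace Ω] {P : Measure Ω}
    {Y : Ω → ℝ} (hY : HasGaussianLaw Y P) (h0 : ∫ ω, Y ω ∂P = 0) {l : ℝ} (hl : 0 ≤ l) (x : ℝ) :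
    P {ω | x < |Y ω|} ≤ ENNReal.ofReal (2 * Real.exp (Var[Y; P] * l ^ 2 / 2 - l * x)) := by
  have := hY.isProbabilityMeasure
  have tail : ∀ Z : Ω → ℝ, HasGaussianLaw Z P → ∫ ω, Z ω ∂P = 0 → Var[Z; P] = Var[Y; P] →
      P {ω | x ≤ Z ω} ≤ ENNReal.ofReal (Real.exp (Var[Y; P] * l ^ 2 / 2 - l * x)) := by
    intro Z hZ hZ0 hv
    have hlaw : P.map Z = gaussianReal 0 (Var[Y; P]).toNNReal := by
      rw [hZ.map_eq_gaussianReal, hZ0, hv]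
    have hint : Integrable (fun ω => Real.exp (l * Z ω)) P := by
      have h1 := integrable_exp_mul_gaussianReal (μ := 0) (v := (Var[Y; P]).toNNReal) l
      rw [← hlaw] at h1
      exact (integrable_map_measure (by fun_prop) hZ.aemeasurable).1 h1
    have h := measure_ge_le_exp_mul_mgf x hl hint
    rw [mgf_gaussianReal hlaw, ← Real.exp_add] at h
    have h2 : P {ω | x ≤ Z ω} = ENNReal.ofReal (P.real {ω | x ≤ Z ω}) := by simp
    rw [h2]
    refine ENNReal.ofReal_le_ofReal (h.trans_eq ?_)
    rw [Real.coe_toNNReal _ (variance_nonneg _ _)]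
    ring_nf
  have hsub : {ω | x < |Y ω|} ⊆ {ω | x ≤ Y ω} ∪ {ω | x ≤ (-Y) ω} := by
    intro ω hω
    rcases lt_abs.1 (show x < |Y ω| from hω) with h | h
    · exact Or.inl h.le
    · exact Or.inr h.le
  refine (measure_mono hsub).trans ((measure_union_le _ _).trans ?_)
  rw [two_mul, ENNReal.ofReal_add (by positivity) (by positivity)]
  refine add_le_add (tail Y hY h0 rfl) (tail (-Y) hY.neg ?_ variance_neg)
  simp [integral_neg, h0]

theorem IsCenteredContinuous.integral_sub {T Ω : Type*} [TopologicalSpace T] [MeasurableSpace Ω]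
    {X : T → Ω → ℝ} {P : Measure Ω} (hX : IsCenteredContinuous X P) (s t : T) :
    ∫ ω, X s ω - X t ω ∂P = 0 := by
  rw [MeasureTheory.integral_sub (hX.gaussian.hasGaussianLaw_eval s).integrable
    (hX.gaussian.hasGaussianLaw_eval t).integrable, hX.centered, hX.centered, sub_zero]

/-- The increment bounds used for chaining: geometric decay times a linear factor. -/
noncomputable def chainBound (ν β x : ℝ) (k : ℕ) : ℝ :=
  ((1 / 2 : ℝ) ^ (ν / 2)) ^ k * (k * β + x)

theorem half_rpow_lt_one {ν : ℝ} (hν : 0 < ν) : ((1 / 2 : ℝ) ^ (ν / 2)) < 1 :=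
  Real.rpow_lt_one (by norm_num) (by norm_num) (by positivity)

theorem summable_chainBound {ν : ℝ} (hν : 0 < ν) (β x : ℝ) : Summable (chainBound ν β x) := by
  have hq0 : 0 ≤ ((1 / 2 : ℝ) ^ (ν / 2)) := by positivity
  have h1 : Summable fun k : ℕ => (k : ℝ) ^ 1 * ((1 / 2 : ℝ) ^ (ν / 2)) ^ k :=
    summable_pow_mul_geometric_of_norm_lt_one 1 (by
      rw [Real.norm_of_nonneg hq0]; exact half_rpow_lt_one hν)
  have h2 := (summable_geometric_of_lt_one hq0 (half_rpow_lt_one hν)).mul_right x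
  refine ((h1.mul_right β).add h2).congr fun k => ?_
  simp only [chainBound]
  ring

theorem chainBound_nonneg (ν : ℝ) {β x : ℝ} (hβ : 0 ≤ β) (hx : 0 ≤ x) (k : ℕ) :
    0 ≤ chainBound ν β x k := by
  unfold chainBound
  positivity

theorem tsum_chainBound {ν : ℝ} (hν : 0 < ν) (β x : ℝ) :
    ∑' k, chainBound ν β x k =
      ∑' k, chainBound ν β 0 k + (∑' k : ℕ, ((1 / 2 : ℝ) ^ (ν / 2)) ^ k) * x := by
  have hq0 : 0 ≤ ((1 / 2 : ℝ) ^ (ν / 2)) := by positivity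
  rw [← tsum_mul_right, ← (summable_chainBound hν β 0).tsum_add
    ((summable_geometric_of_lt_one hq0 (half_rpow_lt_one hν)).mul_right x)]
  refine tsum_congr fun k => ?_
  simp only [chainBound]
  ring

namespace DyadicNets

variable {T : Type*} [PseudoMetricSpace T] {t₀ : T}

theorem exists_measure_not_controls_le (N : DyadicNets T t₀) {κ ν L : ℝ} (hκ : 0 ≤ κ) (hν : 0 < ν) (hL : 0 < L) :
    ∃ β C : ℝ, 0 ≤ β ∧ 0 ≤ C ∧ ∀ {Ω : Type*} [MeasurableSpace Ω] (P : Measure Ω) (X : T → Ω → ℝ),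
      IsHolderGaussian X P κ ν → ∀ x : ℝ,
        P {ω | ¬ N.Controls (chainBound ν β x) fun t => X t ω} ≤
          ENNReal.ofReal (C * Real.exp (-L * x)) := by
  set A := N.growth with hA
  have hA0 : 0 ≤ A := N.growth_nonneg
  set κ' := κ * (4 * N.scale) ^ ν with hκ'
  set q : ℝ := (1 / 2 : ℝ) ^ (ν / 2) with hq
  have hq0 : 0 < q := by positivity
  set c := (1 + A) * (2 * Real.exp (κ' * L ^ 2 / 2)) with hc
  have hc0 : 0 ≤ c := by positivity
  have hlog : 0 ≤ Real.log (2 * (A ^ 2 + 1)) := Real.log_nonneg (by nlinarith [sq_nonneg A])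
  -- This slope gives a factor (2(A² + 1))^(-k) at level `k`, which beats the number of pairs, of
  -- order A^(2k), and leaves a geometric series of ratio 1/2.
  refine ⟨Real.log (2 * (A ^ 2 + 1)) / L, 2 * c, by positivity, by positivity, ?_⟩
  set β := Real.log (2 * (A ^ 2 + 1)) / L with hβ
  intro Ω _ P X hX x
  have hpair : ∀ k, ∀ p ∈ N.pairs k, P {ω | chainBound ν β x k < |X p.1 ω - X p.2 ω|} ≤
      ENNReal.ofReal (2 * Real.exp (κ' * L ^ 2 / 2) *
        (Real.exp (-L * x) * (1 / (2 * (A ^ 2 + 1))) ^ k)) := by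
    intro k p hp
    have hv : Var[fun ω => X p.1 ω - X p.2 ω; P] ≤ κ' * (q ^ k) ^ 2 := by
      refine (hX.variance_sub_le p.1 p.2).trans ?_
      have h1 : dist p.1 p.2 ^ ν ≤ (4 * N.scale * (1 / 2) ^ k) ^ ν :=
        Real.rpow_le_rpow dist_nonneg hp.2.2 hν.le
      have h2 : (4 * N.scale * (1 / 2 : ℝ) ^ k) ^ ν = (4 * N.scale) ^ ν * (q ^ k) ^ 2 := by
        have := N.scale_pos
        rw [Real.mul_rpow (by positivity) (by positivity), hq, ← Real.rpow_natCast,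
          ← Real.rpow_natCast, ← Real.rpow_natCast, ← Real.rpow_mul (by positivity),
          ← Real.rpow_mul (by positivity), ← Real.rpow_mul (by positivity)]
        congr 2
        push_cast
        ring
      rw [hκ', mul_assoc, ← h2]
      exact mul_le_mul_of_nonneg_left h1 hκ
    -- Increments at level `k` have standard deviation of order q^k, so l = L/q^k makes the
    -- quadratic term of the exponent independent of `k`.
    refine (measure_lt_abs_le_of_hasGaussianLaw hX.gaussian.hasGaussianLaw_fun_sub
      (hX.toIsCenteredContinuous.integral_sub p.1 p.2) (l := L / q ^ k) (by positivity) _).trans ?_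
    refine ENNReal.ofReal_le_ofReal ?_
    rw [mul_assoc]
    refine mul_le_mul_of_nonneg_left ?_ zero_le_two
    have e1 : Real.exp (-L * x) * (1 / (2 * (A ^ 2 + 1))) ^ k =
        Real.exp (- L * x - k * (L * β)) := by
      have : L * β = Real.log (2 * (A ^ 2 + 1)) := by rw [hβ]; field_simp
      rw [this, sub_eq_add_neg, Real.exp_add, Real.exp_neg, Real.exp_nat_mul,
        Real.exp_log (by positivity), one_div, inv_pow]
    rw [e1, ← Real.exp_add]
    refine Real.exp_le_exp.2 ?_
    have e2 : L / q ^ k * chainBound ν β x k = L * (k * β + x) := by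
      unfold chainBound
      rw [← hq]
      field_simp
    have e3 : Var[fun ω => X p.1 ω - X p.2 ω; P] * (L / q ^ k) ^ 2 ≤ κ' * L ^ 2 := by
      calc _ ≤ κ' * (q ^ k) ^ 2 * (L / q ^ k) ^ 2 :=
            mul_le_mul_of_nonneg_right hv (sq_nonneg _)
        _ = κ' * L ^ 2 := by field_simp
    rw [e2]
    linarith
  have hsub : {ω | ¬ N.Controls (chainBound ν β x) fun t => X t ω} ⊆
      ⋃ k, ⋃ p ∈ (N.finite_pairs k).toFinset,
        {ω | chainBound ν β x k < |X p.1 ω - X p.2 ω|} := by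
    intro ω hω
    simp only [Controls, not_forall, not_le, Set.mem_ofPred_eq] at hω
    obtain ⟨k, p, hp, h⟩ := hω
    simp only [Set.mem_iUnion, Set.Finite.mem_toFinset]
    exact ⟨k, p, hp, h⟩
  have hlevel : ∀ k, P (⋃ p ∈ (N.finite_pairs k).toFinset,
        {ω | chainBound ν β x k < |X p.1 ω - X p.2 ω|}) ≤
      ENNReal.ofReal (c * Real.exp (-L * x) * (1 / 2) ^ k) := by
    intro k
    refine (measure_biUnion_finset_le _ _).trans ?_
    refine (Finset.sum_le_sum fun p hp => hpair k p ((Set.Finite.mem_toFinset _).1 hp)).trans ?_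
    rw [Finset.sum_const, ← Set.ncard_eq_toFinset_card _ (N.finite_pairs k), nsmul_eq_mul,
      ← ENNReal.ofReal_natCast, ← ENNReal.ofReal_mul (by positivity)]
    refine ENNReal.ofReal_le_ofReal ?_
    calc ((N.pairs k).ncard : ℝ) * (2 * Real.exp (κ' * L ^ 2 / 2) *
          (Real.exp (-L * x) * (1 / (2 * (A ^ 2 + 1))) ^ k))
        ≤ ((1 + A) * (A ^ 2) ^ k) * (2 * Real.exp (κ' * L ^ 2 / 2) *
          (Real.exp (-L * x) * (1 / (2 * (A ^ 2 + 1))) ^ k)) :=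
          mul_le_mul_of_nonneg_right (N.ncard_pairs_le k) (by positivity)
      _ = c * Real.exp (-L * x) * (A ^ 2 * (1 / (2 * (A ^ 2 + 1)))) ^ k := by
          rw [hc, mul_pow]; ring
      _ ≤ c * Real.exp (-L * x) * (1 / 2) ^ k := by
          refine mul_le_mul_of_nonneg_left (pow_le_pow_left₀ (by positivity) ?_ k) (by positivity)
          rw [mul_one_div, div_le_div_iff₀ (by positivity) (by norm_num)]
          linarith
  have hgeo : Summable fun k : ℕ => (1 / 2 : ℝ) ^ k := summable_geometric_two
  calc P _ ≤ ∑' k, ENNReal.ofReal (c * Real.exp (-L * x) * (1 / 2) ^ k) :=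
        (measure_mono hsub).trans ((measure_iUnion_le _).trans (ENNReal.tsum_le_tsum hlevel))
    _ = ENNReal.ofReal (∑' k : ℕ, c * Real.exp (-L * x) * (1 / 2) ^ k) :=
        (ENNReal.ofReal_tsum_of_nonneg (fun _ => by positivity) (hgeo.mul_left _)).symm
    _ = _ := by
        rw [tsum_mul_left, tsum_geometric_two]
        ring_nf

/-- Uniform exponential tails of the supremum over a class of Gaussian fields. -/
theorem exists_measure_sup_le (N : DyadicNets T t₀) {κ ν L : ℝ} (hκ : 0 ≤ κ) (hν : 0 < ν) (hL : 0 < L) :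
    ∃ B C : ℝ, 0 ≤ C ∧ ∀ {Ω : Type*} [MeasurableSpace Ω] (P : Measure Ω) (X : T → Ω → ℝ),
      IsHolderGaussian X P κ ν → ∀ x : ℝ, 0 ≤ x →
        P {ω | ∃ t, B + x < |X t ω - X t₀ ω|} ≤ ENNReal.ofReal (C * Real.exp (-L * x)) := by
  set W := ∑' k : ℕ, ((1 / 2 : ℝ) ^ (ν / 2)) ^ k with hW
  have hq0 : 0 ≤ ((1 / 2 : ℝ) ^ (ν / 2)) := by positivity
  have hW0 : 0 < W := by
    have := (summable_geometric_of_lt_one hq0 (half_rpow_lt_one hν)).tsum_pos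
      (fun _ => by positivity) 0 (by simp)
    exact this
  -- The sum of the increment bounds is affine in its parameter with slope `W`; using the parameter
  -- x/W costs a factor `W` in the rate, hence L·W.
  obtain ⟨β, C, hβ, hC, h⟩ := N.exists_measure_not_controls_le hκ hν (mul_pos hL hW0)
  refine ⟨∑' k, chainBound ν β 0 k, C, hC, fun {Ω} _ P X hX x hx => ?_⟩
  have h1 := h P X hX (x / W)
  rw [show -(L * W) * (x / W) = -L * x by field_simp] at h1
  refine le_trans (measure_mono_ae ?_) h1
  filter_upwards [hX.continuous_paths] with ω hω ⟨t, ht⟩ hctrl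
  have h2 := DyadicNets.Controls.abs_sub_base_le hctrl (summable_chainBound hν β _)
    (chainBound_nonneg ν hβ (by positivity)) hω t
  rw [tsum_chainBound hν, ← hW, mul_div_cancel₀ _ hW0.ne'] at h2
  linarith

/-- Uniform stochastic equicontinuity of a class of Gaussian fields. -/
theorem exists_measure_modulus_le (N : DyadicNets T t₀) {κ ν ε : ℝ} (hκ : 0 ≤ κ) (hν : 0 < ν) (hε : 0 < ε) :
    ∃ δ > 0, ∀ {Ω : Type*} [MeasurableSpace Ω] (P : Measure Ω) (X : T → Ω → ℝ),
      IsHolderGaussian X P κ ν →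
        P {ω | ∃ s t, dist s t ≤ δ ∧ ε < |X s ω - X t ω|} ≤ ENNReal.ofReal ε := by
  obtain ⟨β, C, hβ, hC, h⟩ := N.exists_measure_not_controls_le hκ hν one_pos
  obtain ⟨x, hx0, hx⟩ : ∃ x : ℝ, 0 ≤ x ∧ C * Real.exp (-1 * x) ≤ ε := by
    have : Tendsto (fun x : ℝ => C * Real.exp (-x)) atTop (𝓝 (C * 0)) :=
      (Real.tendsto_exp_neg_atTop_nhds_zero).const_mul C
    rw [mul_zero] at this
    obtain ⟨x, h1, h2⟩ := ((eventually_ge_atTop 0).and (this.eventually (gt_mem_nhds hε))).exists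
    exact ⟨x, h1, by simpa using h2.le⟩
  obtain ⟨K, hK⟩ : ∃ K : ℕ, 3 * ∑' k, chainBound ν β x (k + K) < ε := by
    have h1 := (tendsto_sum_nat_add (chainBound ν β x)).const_mul 3
    rw [mul_zero] at h1
    exact (h1.eventually (gt_mem_nhds hε)).exists
  refine ⟨N.scale * (1 / 2) ^ K, mul_pos N.scale_pos (by positivity), fun {Ω} _ P X hX => ?_⟩
  refine le_trans (measure_mono_ae ?_)
    ((h P X hX x).trans (ENNReal.ofReal_le_ofReal hx))
  filter_upwards [hX.continuous_paths] with ω hω ⟨s, t, hst, ht⟩ hctrl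
  have h2 := DyadicNets.Controls.abs_sub_le hctrl (summable_chainBound hν β _)
    (chainBound_nonneg ν hβ hx0) hω K hst
  linarith

end DyadicNets

/-! ### Dyadic nets in compact Euclidean sets -/

theorem dist_le_of_floor_eq {n k : ℕ} {x y : EuclideanSpace ℝ (Fin n)}
    (h : ∀ i, ⌊(2 : ℝ) ^ k * x i⌋ = ⌊(2 : ℝ) ^ k * y i⌋) :
    dist x y ≤ √n * (1 / 2) ^ k := by
  rw [EuclideanSpace.dist_eq]
  have hi : ∀ i, dist (x i) (y i) ≤ (1 / 2 : ℝ) ^ k := by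
    intro i
    have h1 := Int.abs_sub_lt_one_of_floor_eq_floor (h i)
    rw [← mul_sub, abs_mul, abs_of_pos (by positivity : (0 : ℝ) < 2 ^ k)] at h1
    rw [Real.dist_eq, one_div, inv_pow, ← one_div, le_div_iff₀ (by positivity)]
    linarith
  calc √(∑ i, dist (x i) (y i) ^ 2) ≤ √(∑ _i : Fin n, ((1 / 2 : ℝ) ^ k) ^ 2) := by
        gcongr with i _
        exact hi i
    _ = √n * (1 / 2) ^ k := by
        rw [Finset.sum_const, Finset.card_univ, Fintype.card_fin, nsmul_eq_mul,
          Real.sqrt_mul (by positivity), Real.sqrt_sq (by positivity)]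

theorem nonempty_dyadicNets {n : ℕ} {D : Set (EuclideanSpace ℝ (Fin n))} (hD : IsCompact D)
    (t₀ : D) : Nonempty (DyadicNets D t₀) := by
  classical
  obtain ⟨R', hR'⟩ := hD.isBounded.exists_norm_le
  obtain ⟨R, hR⟩ := exists_nat_ge (max R' 1)
  have hR1 : (1 : ℝ) ≤ R := (le_max_right _ _).trans hR
  have hcoord : ∀ t : D, ∀ i, |(t : EuclideanSpace ℝ (Fin n)) i| ≤ R := fun t i =>
    (PiLp.norm_apply_le (t : EuclideanSpace ℝ (Fin n)) i).trans
      ((hR' t t.2).trans ((le_max_left _ _).trans hR))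
  let code : ℕ → D → Fin n → ℤ := fun k t i => ⌊(2 : ℝ) ^ k * (t : EuclideanSpace ℝ (Fin n)) i⌋
  have : Nonempty D := ⟨t₀⟩
  -- Grid points may lie outside `D`, so each occupied dyadic cube is represented by one of its
  -- points in `D`.
  let rep : ℕ → (Fin n → ℤ) → D := fun k => Function.invFun (code k)
  have hrep : ∀ k t, code k (rep k (code k t)) = code k t := fun k t =>
    Function.invFun_eq ⟨t, rfl⟩
  let box : ℕ → Finset (Fin n → ℤ) := fun k =>
    Fintype.piFinset fun _ => Finset.Icc (-(R * 2 ^ k : ℤ)) (R * 2 ^ k)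
  have hbox : ∀ k t, code k t ∈ box k := by
    intro k t
    refine Fintype.mem_piFinset.2 fun i => Finset.mem_Icc.2 ?_
    have h1 := abs_le.1 (hcoord t i)
    have h2 : (0 : ℝ) < 2 ^ k := by positivity
    constructor
    · refine Int.le_floor.2 ?_
      push_cast
      nlinarith
    · have := Int.floor_le ((2 : ℝ) ^ k * (t : EuclideanSpace ℝ (Fin n)) i)
      have h3 : (code k t i : ℝ) ≤ R * 2 ^ k := by
        change (⌊(2 : ℝ) ^ k * (t : EuclideanSpace ℝ (Fin n)) i⌋ : ℝ) ≤ _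
        nlinarith
      exact_mod_cast h3
  let proj : ℕ → D → D := fun k t => if k = 0 then t₀ else rep k (code k t)
  have hrange : ∀ k, k ≠ 0 → Set.range (proj k) ⊆ ((box k).image (rep k) : Finset D) := by
    rintro k hk _ ⟨t, rfl⟩
    simp only [proj, hk, if_false, Finset.coe_image]
    exact ⟨_, hbox k t, rfl⟩
  have hzero : Set.range (proj 0) ⊆ {t₀} := by
    rintro _ ⟨t, rfl⟩
    simp [proj]
  -- For k ≥ 1 the box has (2R·2^k + 1)^n ≤ (8R)^(nk) points. In the scale, √n serves the levels k ≥
  -- 1, the diameter serves level 0, where everything projects to `t₀`, and 1 ensures positivity.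
  refine ⟨⟨proj, (8 * R) ^ n, √n + Metric.diam D + 1, by positivity, ?_, fun t => by simp [proj],
    fun k => ?_, fun k => ?_, fun k t => ?_⟩⟩
  · have := Metric.diam_nonneg (s := D)
    positivity
  · rcases eq_or_ne k 0 with rfl | hk
    · exact (Set.finite_singleton t₀).subset hzero
    · exact (Finset.finite_toSet _).subset (hrange k hk)
  · rcases eq_or_ne k 0 with rfl | hk
    · have := Set.ncard_le_ncard hzero (Set.finite_singleton t₀)
      rw [Set.ncard_singleton] at this
      rw [pow_zero]
      exact_mod_cast this
    · have h1 := Set.ncard_le_ncard (hrange k hk) (Finset.finite_toSet _)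
      rw [Set.ncard_coe_finset] at h1
      have h2 := h1.trans Finset.card_image_le
      have h3 : (box k).card = (2 * R * 2 ^ k + 1) ^ n := by
        simp only [box, Fintype.card_piFinset, Finset.prod_const, Finset.card_univ,
          Fintype.card_fin, Int.card_Icc]
        congr 1
        have : (0 : ℤ) ≤ R * 2 ^ k := by positivity
        zify
        rw [Int.toNat_of_nonneg (by linarith)]
        ring
      rw [h3] at h2
      have h4 : ((Set.range (proj k)).ncard : ℝ) ≤ (2 * R * 2 ^ k + 1) ^ n := by exact_mod_cast h2
      refine h4.trans ?_
      rw [← pow_mul, mul_comm n k, pow_mul]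
      refine pow_le_pow_left₀ (by positivity) ?_ n
      obtain ⟨j, rfl⟩ := Nat.exists_eq_succ_of_ne_zero hk
      have h5 : (1 : ℝ) ≤ 2 ^ j := one_le_pow₀ (by norm_num)
      have h6 : (2 : ℝ) ^ j ≤ (8 * R) ^ j := pow_le_pow_left₀ (by norm_num) (by linarith) j
      rw [Nat.succ_eq_add_one, pow_succ, pow_succ]
      nlinarith
  · have hd := Metric.diam_nonneg (s := D)
    have hpos : (0 : ℝ) < (1 / 2) ^ k := by positivity
    rcases eq_or_ne k 0 with rfl | hk
    · have h1 := Metric.dist_le_diam_of_mem hD.isBounded t₀.2 t.2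
      have h2 := Real.sqrt_nonneg n
      simp only [proj, if_true, pow_zero, Subtype.dist_eq]
      linarith
    · have h1 : dist (proj k t) t ≤ √n * (1 / 2) ^ k := by
        simp only [proj, hk, if_false]
        exact dist_le_of_floor_eq fun i => congrFun (hrep k t) i
      nlinarith

/-! ### Fields as random elements of the path space -/

section PathSpace

open TopologicalSpace (denseSeq denseRange_denseSeq)

variable {T : Type*} [MetricSpace T] [CompactSpace T] [Nonempty T]
  [MeasurableSpace C(T, ℝ)] [BorelSpace C(T, ℝ)]

/-- A continuous path can be reconstructed measurably from its values on a dense sequence. -/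
theorem exists_measurable_reconstruction :
    ∃ R : (ℕ → ℝ) → C(T, ℝ), Measurable R ∧
      ∀ f : C(T, ℝ), R (fun n => f (denseSeq T n)) = f := by
  let J : C(T, ℝ) → ℕ → ℝ := fun f n => f (denseSeq T n)
  have hJ : Continuous J := by fun_prop
  have hinj : Function.Injective J := by
    intro f g hfg
    refine ContinuousMap.coe_injective
      ((denseRange_denseSeq T).equalizer f.continuous g.continuous ?_)
    exact hfg
  -- Lusin–Souslin: a continuous injection of a Polish space is a measurable embedding, so its
  -- inverse extends measurably.
  obtain ⟨R, hR, hRJ⟩ := (hJ.measurableEmbedding hinj).exists_measurable_extend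
    measurable_id (fun _ => inferInstance)
  exact ⟨R, hR, fun f => congrFun hRJ f⟩

variable (T) in
/-- Measurable reconstruction of a continuous path from its values on a dense sequence. -/
noncomputable def reconstruct : (ℕ → ℝ) → C(T, ℝ) :=
  (exists_measurable_reconstruction (T := T)).choose

theorem measurable_reconstruct : Measurable (reconstruct T) :=
  (exists_measurable_reconstruction (T := T)).choose_spec.1

theorem reconstruct_apply (f : C(T, ℝ)) : reconstruct T (fun n => f (denseSeq T n)) = f :=
  (exists_measurable_reconstruction (T := T)).choose_spec.2 f

variable {Ω : Type*}

/-- The random path of a field, as a random element of `C(T, ℝ)`. -/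
noncomputable def path (X : T → Ω → ℝ) (ω : Ω) : C(T, ℝ) :=
  reconstruct T fun n => X (denseSeq T n) ω

theorem path_eq {X : T → Ω → ℝ} {ω : Ω} (h : Continuous fun t => X t ω) :
    path X ω = ⟨fun t => X t ω, h⟩ :=
  reconstruct_apply (⟨fun t => X t ω, h⟩ : C(T, ℝ))

variable [MeasurableSpace Ω]

theorem IsCenteredContinuous.ae_path_eq {X : T → Ω → ℝ} {P : Measure Ω}
    (hX : IsCenteredContinuous X P) : ∀ᵐ ω ∂P, ∀ t, path X ω t = X t ω := by
  filter_upwards [hX.continuous_paths] with ω hω t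
  rw [path_eq hω]
  rfl

theorem IsCenteredContinuous.aemeasurable_path {X : T → Ω → ℝ} {P : Measure Ω}
    (hX : IsCenteredContinuous X P) : AEMeasurable (path X) P :=
  measurable_reconstruct.comp_aemeasurable
    (aemeasurable_pi_iff.2 fun _ => hX.gaussian.aemeasurable _)

end PathSpace

/-! ### Weak convergence of Gaussian paths -/

/-- Averaging at scale `δ` with respect to a continuous partition of unity. -/
theorem exists_interpolation {T : Type*} [MetricSpace T] [CompactSpace T] {δ : ℝ} (hδ : 0 < δ) :
    ∃ (I : Finset T) (φ : C((I → ℝ), C(T, ℝ))), ∀ (f : C(T, ℝ)) (ε : ℝ), 0 ≤ ε →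
      (∀ s t, dist s t ≤ δ → |f s - f t| ≤ ε) → dist f (φ fun i => f i) ≤ ε := by
  obtain ⟨I, -, hI⟩ := isCompact_univ.elim_nhds_subcover (fun t : T => Metric.ball t δ)
    (fun t _ => Metric.ball_mem_nhds t hδ)
  -- The tent at `i` vanishes at distance `δ` and beyond, so the average at `t` only uses values of
  -- `f` at points within `δ` of `t`.
  let w : T → C(T, ℝ) := fun i => ⟨fun t => max 0 (δ - dist t i), by fun_prop⟩
  have hw0 : ∀ i t, 0 ≤ w i t := fun i t => le_max_left _ _
  let S : C(T, ℝ) := ∑ i : I, w i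
  have hS : ∀ t, 0 < S t := by
    intro t
    obtain ⟨i, hi, hti⟩ := Set.mem_iUnion₂.1 (hI (Set.mem_univ t))
    have h1 : S t = ∑ i : I, w i t := by simp [S, ContinuousMap.sum_apply]
    rw [h1]
    refine Finset.sum_pos' (fun j _ => hw0 j t) ⟨⟨i, hi⟩, Finset.mem_univ _, ?_⟩
    exact lt_max_of_lt_right (sub_pos.2 hti)
  let Sinv : C(T, ℝ) := ⟨fun t => (S t)⁻¹, S.continuous.inv₀ fun t => (hS t).ne'⟩
  refine ⟨I, ⟨fun a => Sinv * ∑ i : I, a i • w i, by fun_prop⟩, fun f ε hε hf => ?_⟩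
  rw [ContinuousMap.dist_le hε]
  intro t
  have h1 : S t = ∑ i : I, w i t := by simp [S, ContinuousMap.sum_apply]
  have hSt := hS t
  have h2 : f t - (S t)⁻¹ * ∑ i : I, f i * w i t = (S t)⁻¹ * ∑ i : I, (f t - f i) * w i t := by
    simp only [sub_mul, Finset.sum_sub_distrib, ← Finset.mul_sum]
    rw [← h1]
    field_simp
  have h3 : |∑ i : I, (f t - f i) * w i t| ≤ ε * S t := by
    rw [h1, Finset.mul_sum]
    refine (Finset.abs_sum_le_sum_abs _ _).trans (Finset.sum_le_sum fun i _ => ?_)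
    rw [abs_mul, abs_of_nonneg (hw0 i t)]
    rcases le_or_gt (dist t i) δ with h | h
    · exact mul_le_mul_of_nonneg_right (hf _ _ h) (hw0 _ _)
    · have : w i t = 0 := max_eq_left (by linarith)
      simp [this]
  simp only [ContinuousMap.coe_mk, ContinuousMap.mul_apply, ContinuousMap.sum_apply,
    ContinuousMap.smul_apply, smul_eq_mul]
  rw [Real.dist_eq, show Sinv t = (S t)⁻¹ from rfl, h2, abs_mul, abs_of_pos (inv_pos.2 hSt),
    inv_mul_le_iff₀ hSt, mul_comm]
  exact h3

theorem IsCenteredContinuous.memLp_two {T Ω : Type*} [TopologicalSpace T] [MeasurableSpace Ω]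
    {X : T → Ω → ℝ} {P : Measure Ω} (hX : IsCenteredContinuous X P) (t : T) : MemLp (X t) 2 P :=
  (hX.gaussian.hasGaussianLaw_eval t).memLp_two

/-- A linear combination of values is a centered normal variable whose variance is the quadratic
form of the covariances. Thus covariances alone determine the finite-dimensional laws. -/
theorem IsCenteredContinuous.charFun_toLp {T Ω : Type*} [TopologicalSpace T] [MeasurableSpace Ω]
    {X : T → Ω → ℝ} {P : Measure Ω} (hX : IsCenteredContinuous X P) (I : Finset T)
    (a : EuclideanSpace ℝ I) :
    charFun (P.map fun ω => WithLp.toLp 2 fun i : I => X i ω) a =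
      Complex.exp (-((∑ i, ∑ j, a i * a j * cov[X i, X j; P] : ℝ) : ℂ) / 2) := by
  have := hX.gaussian.isProbabilityMeasure
  have hG : HasGaussianLaw (fun ω => WithLp.toLp 2 fun i : I => X i ω) P :=
    (hX.gaussian.hasGaussianLaw I).toLp_pi 2
  have hinner : (fun ω => inner ℝ a (WithLp.toLp 2 fun i : I => X i ω)) =
      fun ω => ∑ i : I, a i * X i ω := by
    ext ω
    simp [PiLp.inner_apply, mul_comm]
  have hmem : ∀ i : I, MemLp (fun ω => a i * X i ω) 2 P := fun i => (hX.memLp_two i).const_mul _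
  have hint : ∫ ω, ∑ i : I, a i * X i ω ∂P = 0 := by
    rw [integral_finsetSum _ fun i _ => (hmem i).integrable one_le_two]
    simp [integral_const_mul, hX.centered]
  have hvar : Var[fun ω => ∑ i : I, a i * X i ω; P] =
      ∑ i, ∑ j, a i * a j * cov[X i, X j; P] := by
    rw [← covariance_self (memLp_finsetSum _ fun i _ => hmem i).aemeasurable,
      covariance_fun_sum_fun_sum hmem hmem]
    refine Finset.sum_congr rfl fun i _ => Finset.sum_congr rfl fun j _ => ?_
    rw [covariance_const_mul_left, covariance_const_mul_right, mul_assoc]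
  rw [hG.charFun_map_eq, hinner, hint, hvar]
  simp [neg_div]

section WeakConvergence

variable {T : Type*} [MetricSpace T] [CompactSpace T] [Nonempty T]
  [MeasurableSpace C(T, ℝ)] [BorelSpace C(T, ℝ)]
  {Ω : ℕ → Type*} [∀ k, MeasurableSpace (Ω k)] {P : ∀ k, Measure (Ω k)}
  [∀ k, IsProbabilityMeasure (P k)] {X : ∀ k, T → Ω k → ℝ}
  {Ω' : Type*} [MeasurableSpace Ω'] {Q : Measure Ω'} [IsProbabilityMeasure Q] {Y : T → Ω' → ℝ}

/-- Lévy's continuity theorem: the characteristic functions depend continuously on the covariances.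
-/
theorem tendstoInDistribution_restrict (hX : ∀ k, IsCenteredContinuous (X k) (P k))
    (hY : IsCenteredContinuous Y Q)
    (hcov : ∀ s t, Tendsto (fun k => cov[X k s, X k t; P k]) atTop (𝓝 cov[Y s, Y t; Q]))
    (I : Finset T) :
    TendstoInDistribution (fun k ω (i : I) => X k i ω) atTop (fun ω (i : I) => Y i ω) P Q := by
  have key : TendstoInDistribution (fun k ω => WithLp.toLp 2 fun i : I => X k i ω) atTop
      (fun ω => WithLp.toLp 2 fun i : I => Y i ω) P Q := by
    refine ⟨fun k => (((hX k).gaussian.hasGaussianLaw I).toLp_pi 2).aemeasurable,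
      ((hY.gaussian.hasGaussianLaw I).toLp_pi 2).aemeasurable, ?_⟩
    refine ProbabilityMeasure.tendsto_of_tendsto_charFun fun a => ?_
    simp only [ProbabilityMeasure.coe_mk]
    rw [hY.charFun_toLp I a]
    simp_rw [fun k => (hX k).charFun_toLp I a]
    refine (Complex.continuous_exp.tendsto _).comp (Tendsto.div_const (Tendsto.neg ?_) _)
    refine (Complex.continuous_ofReal.tendsto _).comp ?_
    exact tendsto_finsetSum _ fun i _ => tendsto_finsetSum _ fun j _ => (hcov i j).const_mul _
  exact key.continuous_comp (g := WithLp.ofLp) (by fun_prop)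

/-- Where `U` and `V` are `ε`-close the Lipschitz bound costs L·ε; elsewhere, on an event of
probability at most `ε`, the oscillation `c` of `h` is paid. That event need not be measurable,
hence its measurable hull. -/
theorem abs_integral_sub_le {Ω E : Type*} [MeasurableSpace Ω] [PseudoMetricSpace E]
    {P : Measure Ω} [IsProbabilityMeasure P] {U V : Ω → E} {h : E → ℝ} {c ε : ℝ} {L : NNReal}
    (hc : ∀ x y, dist (h x) (h y) ≤ c) (hL : LipschitzWith L h) (hε : 0 ≤ ε)
    (hU : AEStronglyMeasurable (fun ω => h (U ω)) P)
    (hV : AEStronglyMeasurable (fun ω => h (V ω)) P)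
    (hUV : P {ω | ε < dist (U ω) (V ω)} ≤ ENNReal.ofReal ε) :
    |∫ ω, h (U ω) ∂P - ∫ ω, h (V ω) ∂P| ≤ (L + c) * ε := by
  have hΩ : Nonempty Ω := nonempty_of_isProbabilityMeasure P
  obtain ⟨ω₀⟩ := hΩ
  have hc0 : 0 ≤ c := dist_nonneg.trans (hc (U ω₀) (U ω₀))
  have bdd : ∀ W : Ω → E, AEStronglyMeasurable (fun ω => h (W ω)) P →
      Integrable (fun ω => h (W ω)) P := fun W hW =>
    Integrable.of_bound hW (|h (U ω₀)| + c) (ae_of_all _ fun ω => by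
      have h1 := hc (W ω) (U ω₀)
      rw [Real.dist_eq] at h1
      have h2 := abs_sub_abs_le_abs_sub (h (W ω)) (h (U ω₀))
      rw [Real.norm_eq_abs]
      linarith)
  set B := toMeasurable P {ω | ε < dist (U ω) (V ω)} with hB
  have hBm : MeasurableSet B := measurableSet_toMeasurable _ _
  have hPB : P.real B ≤ ε := by
    rw [Measure.real, hB, measure_toMeasurable]
    exact ENNReal.toReal_le_of_le_ofReal hε hUV
  rw [← integral_sub (bdd U hU) (bdd V hV)]
  have hpt : ∀ ω, ‖h (U ω) - h (V ω)‖ ≤ L * ε + B.indicator (fun _ => c) ω := by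
    intro ω
    rw [Real.norm_eq_abs, ← Real.dist_eq]
    by_cases hω : ω ∈ B
    · rw [Set.indicator_of_mem hω]
      have := hc (U ω) (V ω)
      have h2 : 0 ≤ L * ε := by positivity
      linarith
    · rw [Set.indicator_of_notMem hω, add_zero]
      have h1 : dist (U ω) (V ω) ≤ ε := by
        by_contra hcon
        exact hω (subset_toMeasurable _ _ (not_le.1 hcon))
      exact (hL.dist_le_mul _ _).trans (mul_le_mul_of_nonneg_left h1 L.2)
  have hi : Integrable (fun ω => L * ε + B.indicator (fun _ => c) ω) P :=
    (integrable_const _).add ((integrable_const c).indicator hBm)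
  calc |∫ ω, h (U ω) - h (V ω) ∂P| ≤ ∫ ω, (L * ε + B.indicator (fun _ => c) ω) ∂P :=
        norm_integral_le_of_norm_le hi (ae_of_all _ hpt)
    _ = L * ε + P.real B * c := by
        rw [integral_add (integrable_const _) ((integrable_const c).indicator hBm),
          integral_indicator_const c hBm]
        simp
    _ ≤ L * ε + ε * c := by gcongr
    _ = _ := by ring

theorem abs_integral_path_sub_le {Ω : Type*} [MeasurableSpace Ω] {P : Measure Ω}
    [IsProbabilityMeasure P] {Z : T → Ω → ℝ} (hZ : IsCenteredContinuous Z P)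
    {h : C(T, ℝ) → ℝ} {c ε δ : ℝ} {L : NNReal} (hc : ∀ x y, dist (h x) (h y) ≤ c)
    (hL : LipschitzWith L h) (hε : 0 ≤ ε) {I : Finset T} {φ : C((I → ℝ), C(T, ℝ))}
    (hφ : ∀ (f : C(T, ℝ)) (ε : ℝ), 0 ≤ ε →
      (∀ s t, dist s t ≤ δ → |f s - f t| ≤ ε) → dist f (φ fun i => f i) ≤ ε)
    (hmod : P {ω | ∃ s t, dist s t ≤ δ ∧ ε < |Z s ω - Z t ω|} ≤ ENNReal.ofReal ε) :
    |∫ ω, h (path Z ω) ∂P - ∫ ω, h (φ fun i => Z i ω) ∂P| ≤ (L + c) * ε := by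
  refine abs_integral_sub_le (V := fun ω => φ fun i => Z i ω) hc hL hε
    (hL.continuous.measurable.comp_aemeasurable hZ.aemeasurable_path).aestronglyMeasurable
    ((hL.continuous.comp φ.continuous).measurable.comp_aemeasurable
      (aemeasurable_pi_iff.2 fun i => hZ.gaussian.aemeasurable _)).aestronglyMeasurable ?_
  refine (measure_mono_ae ?_).trans hmod
  filter_upwards [hZ.ae_path_eq] with ω hω hlt
  by_contra hcon
  refine absurd (hφ (path Z ω) ε hε fun s t hst => ?_) (not_le.2 ?_)
  · rw [hω, hω]
    exact not_lt.1 fun h => hcon ⟨s, t, hst, h⟩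
  · simp_rw [hω]
    exact hlt

/-- Convergence in distribution in `C(T, ℝ)` of centered Gaussian fields, from convergence of the
covariances and uniform stochastic equicontinuity. -/
theorem tendstoInDistribution_path (hX : ∀ k, IsCenteredContinuous (X k) (P k))
    (hY : IsCenteredContinuous Y Q)
    (hcov : ∀ s t, Tendsto (fun k => cov[X k s, X k t; P k]) atTop (𝓝 cov[Y s, Y t; Q]))
    (hmod : ∀ ε > 0, ∃ δ > 0,
      (∀ k, P k {ω | ∃ s t, dist s t ≤ δ ∧ ε < |X k s ω - X k t ω|} ≤ ENNReal.ofReal ε) ∧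
        Q {ω | ∃ s t, dist s t ≤ δ ∧ ε < |Y s ω - Y t ω|} ≤ ENNReal.ofReal ε) :
    TendstoInDistribution (fun k => path (X k)) atTop (path Y) P Q := by
  refine ⟨fun k => (hX k).aemeasurable_path, hY.aemeasurable_path, ?_⟩
  refine tendsto_iff_forall_lipschitz_integral_tendsto.2 ?_
  rintro h ⟨c, hc⟩ ⟨L, hL⟩
  have hc0 : 0 ≤ c := dist_nonneg.trans (hc 0 0)
  simp only [ProbabilityMeasure.coe_mk]
  rw [integral_map hY.aemeasurable_path hL.continuous.aestronglyMeasurable]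
  simp_rw [fun k => integral_map (hX k).aemeasurable_path hL.continuous.aestronglyMeasurable]
  rw [Metric.tendsto_atTop]
  intro e he
  -- Interpolating the prelimit and the limit path costs at most e/4 each, leaving e/2 for the
  -- finite-dimensional convergence.
  set ε := e / (4 * (L + c + 1)) with hεdef
  have hε : 0 < ε := by positivity
  obtain ⟨δ, hδ, hXmod, hYmod⟩ := hmod ε hε
  obtain ⟨I, φ, hφ⟩ := exists_interpolation (T := T) hδ
  have hfd := ProbabilityMeasure.tendsto_iff_forall_integral_tendsto.1
    (tendstoInDistribution_restrict hX hY hcov I).tendsto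
    (BoundedContinuousFunction.mkOfBound ⟨fun a => h (φ a), hL.continuous.comp φ.continuous⟩ c
      fun x y => hc _ _)
  simp only [ProbabilityMeasure.coe_mk, BoundedContinuousFunction.mkOfBound_coe,
    ContinuousMap.coe_mk] at hfd
  have hcont : Continuous fun a => h (φ a) := hL.continuous.comp φ.continuous
  rw [integral_map (tendstoInDistribution_restrict hX hY hcov I).aemeasurable_limit
    hcont.aestronglyMeasurable] at hfd
  simp_rw [fun k => integral_map
    ((tendstoInDistribution_restrict hX hY hcov I).forall_aemeasurable k)
    hcont.aestronglyMeasurable] at hfd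
  obtain ⟨N, hN⟩ := Metric.tendsto_atTop.1 hfd (e / 2) (by positivity)
  refine ⟨N, fun k hk => ?_⟩
  have h1 := abs_integral_path_sub_le (hX k) hc hL hε.le hφ (hXmod k)
  have h2 := abs_integral_path_sub_le hY hc hL hε.le hφ hYmod
  have h3 := hN k hk
  have h4 : (L + c) * ε ≤ e / 4 := by
    rw [hεdef, mul_div_assoc', div_le_div_iff₀ (by positivity) (by norm_num)]
    nlinarith
  rw [Real.dist_eq] at h3 ⊢
  rw [abs_le] at h1 h2
  rw [abs_lt] at h3 ⊢
  constructor <;> linarith [h1.1, h1.2, h2.1, h2.2, h3.1, h3.2]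

end WeakConvergence

/-! ### Rescaled Gaussian integrals and their limits -/

/-- Substitution x = g - y/g, with -x²/2 = -g²/2 + y - y²/(2g²). -/
theorem integral_gaussianReal_eq_rescaled (h : ℝ → ℝ) {g : ℝ} (hg : 0 < g) :
    ∫ x, h x ∂(gaussianReal 0 1) =
      gaussianPDFReal 0 1 g / g * ∫ y, Real.exp (y - y ^ 2 / (2 * g ^ 2)) * h (g - y / g) := by
  rw [integral_gaussianReal_eq_integral_smul one_ne_zero]
  set f : ℝ → ℝ := fun x => gaussianPDFReal 0 1 x • h x with hf
  have h1 : ∫ x, f x = g⁻¹ * ∫ y, f (g - y / g) := by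
    have := Measure.integral_comp_div (fun z => f (g - z)) g
    rw [this, integral_sub_left_eq_self f volume g, abs_of_pos hg, smul_eq_mul,
      inv_mul_cancel_left₀ hg.ne']
  have h2 : ∀ y, gaussianPDFReal 0 1 (g - y / g) =
      gaussianPDFReal 0 1 g * Real.exp (y - y ^ 2 / (2 * g ^ 2)) := by
    intro y
    simp only [gaussianPDFReal, mul_assoc, ← Real.exp_add]
    congr 2
    simp only [NNReal.coe_one]
    field_simp
    ring
  have h3 : ∫ y, f (g - y / g) = gaussianPDFReal 0 1 g *
      ∫ y, Real.exp (y - y ^ 2 / (2 * g ^ 2)) * h (g - y / g) := by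
    rw [← integral_const_mul]
    simp only [hf, h2, smul_eq_mul, mul_assoc]
  rw [h1, h3]
  ring

/-- The dominating function in the passage to the limit. -/
noncomputable def expBound (K : ℝ) (y : ℝ) : ℝ :=
  (Set.Iic (0 : ℝ)).indicator Real.exp y +
    (Set.Ioi (0 : ℝ)).indicator (fun y => K * Real.exp (-y)) y

theorem integrable_expBound (K : ℝ) : Integrable (expBound K) :=
  ((integrableOn_exp_Iic 0).integrable_indicator measurableSet_Iic).add
    ((integrable_indicator_iff measurableSet_Ioi).2 ((integrableOn_exp_neg_Ioi 0).const_mul K))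

theorem exp_mul_le_expBound {K y p : ℝ} (hp1 : p ≤ 1) (hK : 0 < y → p ≤ K * Real.exp (-2 * y)) :
    Real.exp y * p ≤ expBound K y := by
  rcases le_or_gt y 0 with hy | hy
  · simp only [expBound, Set.indicator_of_mem (Set.mem_Iic.2 hy),
      Set.indicator_of_notMem (Set.notMem_Ioi.2 hy), add_zero]
    exact mul_le_of_le_one_right (Real.exp_pos _).le hp1
  · simp only [expBound, Set.indicator_of_notMem (Set.notMem_Iic.2 hy),
      Set.indicator_of_mem (Set.mem_Ioi.2 hy), zero_add]
    calc Real.exp y * p ≤ Real.exp y * (K * Real.exp (-2 * y)) :=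
          mul_le_mul_of_nonneg_left (hK hy) (Real.exp_pos _).le
      _ = K * Real.exp (-y) := by
          rw [mul_left_comm, ← Real.exp_add]; congr 2; ring

/-- Dominated convergence. For y ≤ 0 the factor e^y is integrable by itself; for y > 0 the decay
e^(-2y) of `p` absorbs it. The limit inherits the bounds, which yields its integrability. -/
theorem tendsto_integral_exp_sub_sq {p : ℕ → ℝ → ℝ} {q : ℝ → ℝ} {g : ℕ → ℝ} {K : ℝ}
    (hg : Tendsto g atTop atTop) (hp : ∀ k, Measurable (p k)) (hp0 : ∀ k y, 0 ≤ p k y)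
    (hp1 : ∀ k y, p k y ≤ 1) (hK : ∀ᶠ k in atTop, ∀ y, 0 < y → p k y ≤ K * Real.exp (-2 * y))
    (hlim : ∀ᵐ y, Tendsto (fun k => p k y) atTop (𝓝 (q y))) :
    (Integrable fun y => Real.exp y * q y) ∧
    Tendsto (fun k => ∫ y, Real.exp (y - y ^ 2 / (2 * g k ^ 2)) * p k y) atTop
      (𝓝 (∫ y, Real.exp y * q y)) := by
  have hle : ∀ k y, Real.exp (y - y ^ 2 / (2 * g k ^ 2)) ≤ Real.exp y := fun k y =>
    Real.exp_le_exp.2 (sub_le_self _ (by positivity))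
  have hq : AEStronglyMeasurable q volume :=
    aestronglyMeasurable_of_tendsto_ae atTop (fun k => (hp k).aestronglyMeasurable) hlim
  constructor
  · refine (integrable_expBound K).mono'
      (Real.continuous_exp.aestronglyMeasurable.mul hq) ?_
    filter_upwards [hlim] with y hy
    rw [Real.norm_of_nonneg (mul_nonneg (Real.exp_pos _).le (ge_of_tendsto' hy fun k => hp0 k y))]
    exact exp_mul_le_expBound (le_of_tendsto' hy fun k => hp1 k y)
      fun hy0 => le_of_tendsto hy (hK.mono fun k hk => hk y hy0)
  · refine tendsto_integral_filter_of_dominated_convergence (expBound K) ?_ ?_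
      (integrable_expBound K) ?_
    · refine Eventually.of_forall fun k => ?_
      have := hp k
      exact (Measurable.mul (by fun_prop) this).aestronglyMeasurable
    · filter_upwards [hK] with k hk
      refine ae_of_all _ fun y => ?_
      rw [Real.norm_of_nonneg (mul_nonneg (Real.exp_pos _).le (hp0 k y))]
      exact (mul_le_mul_of_nonneg_right (hle k y) (hp0 k y)).trans
        (exp_mul_le_expBound (hp1 k y) (hk y))
    · filter_upwards [hlim] with y hy
      refine Tendsto.mul ((Real.continuous_exp.tendsto _).comp ?_) hy
      have : Tendsto (fun k => y ^ 2 / (2 * g k ^ 2)) atTop (𝓝 0) := by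
        refine Tendsto.const_div_atTop ?_ _
        exact ((tendsto_pow_atTop two_ne_zero).comp hg).const_mul_atTop two_pos
      simpa using this.const_sub y

/-- Tonelli, after writing e^G as the integral of e^y over y < G. -/
theorem integral_exp_mul_tail {E : Type*} [MeasurableSpace E] {μ : Measure E}
    [IsProbabilityMeasure μ] {G : E → ℝ} (hG : Measurable G)
    (hint : Integrable fun y => Real.exp y * μ.real {w | y < G w}) :
    Integrable (fun w => Real.exp (G w)) μ ∧
      ∫ w, Real.exp (G w) ∂μ = ∫ y, Real.exp y * μ.real {w | y < G w} := by
  have hexp : ∀ z : ℝ, ∫⁻ y, (Set.Iio z).indicator (fun y => ENNReal.ofReal (Real.exp y)) y =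
      ENNReal.ofReal (Real.exp z) := by
    intro z
    rw [lintegral_indicator measurableSet_Iio, setLIntegral_congr Iio_ae_eq_Iic,
      ← ofReal_integral_eq_lintegral_ofReal (integrableOn_exp_Iic z)
        (ae_of_all _ fun y => (Real.exp_pos y).le), integral_exp_Iic]
  have hS : MeasurableSet {q : ℝ × E | q.1 < G q.2} :=
    measurableSet_lt measurable_fst (hG.comp measurable_snd)
  have hlint : ∫⁻ w, ENNReal.ofReal (Real.exp (G w)) ∂μ =
      ∫⁻ y, ENNReal.ofReal (Real.exp y * μ.real {w | y < G w}) := by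
    rw [lintegral_congr fun w => (hexp (G w)).symm]
    rw [lintegral_lintegral_swap]
    · refine lintegral_congr fun y => ?_
      have hind : ∀ w, (Set.Iio (G w)).indicator (fun y => ENNReal.ofReal (Real.exp y)) y =
          {w | y < G w}.indicator (fun _ => ENNReal.ofReal (Real.exp y)) w := fun w => rfl
      simp_rw [hind]
      rw [lintegral_indicator_const (measurableSet_lt measurable_const hG),
        ENNReal.ofReal_mul (Real.exp_pos y).le, ofReal_measureReal]
    · have : Measurable fun q : E × ℝ => {q : E × ℝ | q.2 < G q.1}.indicator
          (fun q => ENNReal.ofReal (Real.exp q.2)) q :=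
        Measurable.indicator (by fun_prop)
          (measurableSet_lt measurable_snd (hG.comp measurable_fst))
      exact this.aemeasurable
  have hnn : ∀ y, 0 ≤ Real.exp y * μ.real {w | y < G w} := fun y => by positivity
  have hI : Integrable (fun w => Real.exp (G w)) μ := by
    refine ⟨(Real.measurable_exp.comp hG).aestronglyMeasurable, ?_⟩
    rw [hasFiniteIntegral_iff_ofReal (ae_of_all _ fun w => (Real.exp_pos _).le), hlint,
      ← hasFiniteIntegral_iff_ofReal (ae_of_all _ hnn)]
    exact hint.2
  refine ⟨hI, ?_⟩
  rw [integral_eq_lintegral_of_nonneg_ae (ae_of_all _ fun w => (Real.exp_pos _).le) hI.1,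
    integral_eq_lintegral_of_nonneg_ae (ae_of_all _ hnn) hint.1, hlint]

/-- Mills' ratio asymptotics along a sequence. -/
theorem tendsto_normalTail_div {g : ℕ → ℝ} (hg : Tendsto g atTop atTop) (hg0 : ∀ k, 0 < g k) :
    Tendsto (fun k => normalTail (g k) / (gaussianPDFReal 0 1 (g k) / g k)) atTop (𝓝 1) := by
  have heq : ∀ k, normalTail (g k) / (gaussianPDFReal 0 1 (g k) / g k) =
      ∫ y, Real.exp (y - y ^ 2 / (2 * g k ^ 2)) * (Set.Iio (0 : ℝ)).indicator 1 y := by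
    intro k
    have hpos : 0 < gaussianPDFReal 0 1 (g k) / g k :=
      div_pos (gaussianPDFReal_pos _ _ _ one_ne_zero) (hg0 k)
    rw [div_eq_iff hpos.ne', normalTail, ← integral_indicator_one measurableSet_Ioi,
      integral_gaussianReal_eq_rescaled _ (hg0 k), mul_comm]
    congr 2
    ext y
    have hiff : g k - y / g k ∈ Set.Ioi (g k) ↔ y ∈ Set.Iio (0 : ℝ) := by
      rw [Set.mem_Ioi, Set.mem_Iio, lt_sub_iff_add_lt, add_lt_iff_neg_left, div_lt_iff₀ (hg0 k), zero_mul]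
    simp only [Set.indicator_apply, hiff, Pi.one_apply]
  simp_rw [heq]
  have hone : ∫ y, Real.exp y * (Set.Iio (0 : ℝ)).indicator 1 y = 1 := by
    have : (fun y => Real.exp y * (Set.Iio (0 : ℝ)).indicator 1 y) =
        (Set.Iio (0 : ℝ)).indicator Real.exp := by
      ext y
      by_cases hy : y ∈ Set.Iio (0 : ℝ) <;> simp [hy]
    rw [this, integral_indicator measurableSet_Iio, ← integral_Iic_eq_integral_Iio,
      integral_exp_Iic_zero]
  rw [← hone]
  -- Exceeding `g k` means y < 0, so `p` is a fixed indicator that vanishes for y > 0.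
  refine (tendsto_integral_exp_sub_sq (K := 0) (p := fun _ => (Set.Iio (0 : ℝ)).indicator 1) hg
    (fun _ => measurable_one.indicator measurableSet_Iio)
    (fun _ y => Set.indicator_nonneg (fun _ _ => zero_le_one) y)
    (fun _ y => Set.indicator_le_self' (fun _ _ => zero_le_one) y) ?_
    (ae_of_all _ fun y => tendsto_const_nhds)).2
  refine Eventually.of_forall fun k y hy => ?_
  rw [Set.indicator_of_notMem (by simpa using hy.le), zero_mul]

theorem covariance_sq_le {Ω : Type*} [MeasurableSpace Ω] {P : Measure Ω} [IsProbabilityMeasure P]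
    {U V : Ω → ℝ} (hU : MemLp U 2 P) (hV : MemLp V 2 P) :
    cov[U, V; P] ^ 2 ≤ Var[U; P] * Var[V; P] := by
  have h : ∀ x : ℝ, 0 ≤ Var[V; P] * (x * x) + (-2 * cov[U, V; P]) * x + Var[U; P] := by
    intro x
    have h1 := variance_nonneg (fun ω => U ω - x * V ω) P
    rw [variance_fun_sub hU (hV.const_mul x), covariance_const_mul_right, variance_const_mul] at h1
    linarith
  have := discrim_le_zero h
  rw [discrim] at this
  linarith

/-! ### Removing the value at the base point -/

section Residual

variable {T Ω : Type*} [MeasurableSpace Ω]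

/-- The part of the field `X` that is independent of `X t₀` (when `X t₀` has unit variance),
multiplied by `g`. -/
noncomputable def residual (X : T → Ω → ℝ) (P : Measure Ω) (t₀ : T) (g : ℝ) (t : T) (ω : Ω) : ℝ :=
  g * (X t ω - cov[X t, X t₀; P] * X t₀ ω)

variable [PseudoMetricSpace T] {X : T → Ω → ℝ} {P : Measure Ω} [IsProbabilityMeasure P] {t₀ : T}
  {g κ ν : ℝ}

theorem variance_residual_sub (hX : IsCenteredContinuous X P) (h1 : Var[X t₀; P] = 1)
    (g : ℝ) (s t : T) :
    Var[fun ω => residual X P t₀ g s ω - residual X P t₀ g t ω; P] =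
      g ^ 2 * (Var[fun ω => X s ω - X t ω; P] - (cov[X s, X t₀; P] - cov[X t, X t₀; P]) ^ 2) := by
  have hrw : (fun ω => residual X P t₀ g s ω - residual X P t₀ g t ω) = fun ω =>
      g * ((X s ω - X t ω) - (cov[X s, X t₀; P] - cov[X t, X t₀; P]) * X t₀ ω) := by
    ext ω
    simp only [residual]
    ring
  have hs := hX.memLp_two s
  have ht := hX.memLp_two t
  have h0 := hX.memLp_two t₀
  have hst : MemLp (fun ω => X s ω - X t ω) 2 P := hs.sub ht
  rw [hrw, variance_const_mul, variance_fun_sub hst (h0.const_mul _),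
    covariance_const_mul_right, variance_const_mul, covariance_fun_sub_left hs ht h0, h1]
  ring

theorem covariance_residual (hX : IsCenteredContinuous X P) (h1 : Var[X t₀; P] = 1)
    (g : ℝ) (s t : T) :
    cov[residual X P t₀ g s, residual X P t₀ g t; P] =
      g ^ 2 * (cov[X s, X t; P] - cov[X s, X t₀; P] * cov[X t, X t₀; P]) := by
  have hs := hX.memLp_two s
  have ht := hX.memLp_two t
  have h0 := hX.memLp_two t₀
  have h01 : cov[X t₀, X t₀; P] = 1 := by rw [covariance_self h0.aemeasurable, h1]
  unfold residual
  rw [covariance_const_mul_left, covariance_const_mul_right,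
    covariance_fun_sub_fun_sub hs (h0.const_mul _) ht (h0.const_mul _),
    covariance_const_mul_left, covariance_const_mul_left, covariance_const_mul_right,
    covariance_const_mul_right, h01, covariance_comm (X t₀) (X t)]
  ring

/-- The difference of the two sides is the variance of an increment of the residual. It makes the
regression coefficient as regular as the field. -/
theorem covariance_sub_sq_le (hX : IsCenteredContinuous X P) (h1 : Var[X t₀; P] = 1) (s t : T) :
    (cov[X s, X t₀; P] - cov[X t, X t₀; P]) ^ 2 ≤ Var[fun ω => X s ω - X t ω; P] := by
  have h := variance_residual_sub hX h1 1 s t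
  have h2 := variance_nonneg (fun ω => residual X P t₀ 1 s ω - residual X P t₀ 1 t ω) P
  rw [h] at h2
  linarith

theorem continuous_of_sq_sub_le {f : T → ℝ} (hν : 0 < ν)
    (h : ∀ s t, (f s - f t) ^ 2 ≤ κ * dist s t ^ ν) : Continuous f := by
  refine continuous_iff_continuousAt.2 fun t => ?_
  have hlim : Tendsto (fun s => κ * dist s t ^ ν) (𝓝 t) (𝓝 0) := by
    have h1 : Tendsto (fun s => dist s t) (𝓝 t) (𝓝 0) := tendsto_iff_dist_tendsto_zero.1 tendsto_id
    have h2 := (h1.rpow_const (p := ν) (Or.inr hν.le)).const_mul κ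
    rwa [Real.zero_rpow hν.ne', mul_zero] at h2
  have hsq : Tendsto (fun s => (f s - f t) ^ 2) (𝓝 t) (𝓝 0) :=
    squeeze_zero (fun _ => sq_nonneg _) (fun s => h s t) hlim
  have habs : Tendsto (fun s => |f s - f t|) (𝓝 t) (𝓝 0) := by
    simpa [Real.sqrt_sq_eq_abs] using hsq.sqrt
  exact tendsto_iff_norm_sub_tendsto_zero.2 habs

theorem continuous_covariance_base (hX : IsCenteredContinuous X P) (h1 : Var[X t₀; P] = 1)
    (hν : 0 < ν) (hg : 0 < g)
    (hinc : ∀ s t, g ^ 2 * Var[fun ω => X s ω - X t ω; P] ≤ κ * dist s t ^ ν) :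
    Continuous fun t => cov[X t, X t₀; P] := by
  refine continuous_of_sq_sub_le (κ := κ / g ^ 2) hν fun s t => ?_
  refine (covariance_sub_sq_le hX h1 s t).trans ?_
  rw [div_mul_eq_mul_div, le_div_iff₀ (by positivity), mul_comm]
  exact hinc s t

/-- Joint Gaussianity with `X t₀` is what lets zero covariance give independence. -/
theorem isGaussianProcess_residual (hX : IsGaussianProcess X P) :
    IsGaussianProcess (Sum.elim (fun _ : Unit => X t₀) (residual X P t₀ g)) P := by
  classical
  refine hX.of_isGaussianProcess fun s => ?_
  rcases s with s | t
  · exact ⟨{t₀}, ContinuousLinearMap.proj ⟨t₀, by simp⟩, fun ω => rfl⟩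
  · exact ⟨{t, t₀}, g • (ContinuousLinearMap.proj ⟨t, by simp⟩ -
      cov[X t, X t₀; P] • ContinuousLinearMap.proj ⟨t₀, by simp⟩), fun ω => rfl⟩

theorem isHolderGaussian_residual (hX : IsCenteredContinuous X P) (h1 : Var[X t₀; P] = 1)
    (hν : 0 < ν) (hg : 0 < g)
    (hinc : ∀ s t, g ^ 2 * Var[fun ω => X s ω - X t ω; P] ≤ κ * dist s t ^ ν) :
    IsHolderGaussian (residual X P t₀ g) P κ ν where
  gaussian := (isGaussianProcess_residual hX.gaussian).comp_right Sum.inr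
  centered t := by
    have h2 := fun t => (hX.memLp_two t).integrable one_le_two
    simp only [residual]
    rw [integral_const_mul, integral_sub (h2 t) ((h2 t₀).const_mul _), integral_const_mul,
      hX.centered, hX.centered]
    simp
  continuous_paths := by
    have hr := continuous_covariance_base hX h1 hν hg hinc
    filter_upwards [hX.continuous_paths] with ω hω
    exact (hω.sub (hr.mul continuous_const)).const_mul g
  variance_sub_le s t := by
    rw [variance_residual_sub hX h1]
    refine le_trans ?_ (hinc s t)
    gcongr
    exact sub_le_self _ (sq_nonneg _)

end Residual

/-! ### Conditioning on the value at the base point -/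

section Conditioning

variable {T : Type*} [MetricSpace T] [CompactSpace T] [Nonempty T]
  [MeasurableSpace C(T, ℝ)] [BorelSpace C(T, ℝ)] {Ω : Type*} [MeasurableSpace Ω]
  {X : T → Ω → ℝ} {P : Measure Ω} [IsProbabilityMeasure P] {t₀ : T} {g κ ν : ℝ}

/-- The covariance of `X t₀` with the residual at `t` is g(r(t) - r(t) Var X(t₀)) = 0, and the path
is a measurable function of countably many residual values. -/
theorem indepFun_path_residual (hX : IsCenteredContinuous X P) (h1 : Var[X t₀; P] = 1) :
    IndepFun (X t₀) (path (residual X P t₀ g)) P := by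
  have hp : IsGaussianProcess (Sum.elim (fun _ : Unit => X t₀) (residual X P t₀ g)) P :=
    isGaussianProcess_residual hX.gaussian
  have h := hp.indepFun_of_covariance_eq_zero (fun _ => hX.gaussian.aemeasurable t₀)
    (fun t => hp.aemeasurable (Sum.inr t)) (fun _ t => ?_)
  · exact h.comp (φ := fun x : Unit → ℝ => x ()) (ψ := fun f : T → ℝ => reconstruct T fun n =>
      f (TopologicalSpace.denseSeq T n)) (measurable_pi_apply ())
      (measurable_reconstruct.comp (measurable_pi_lambda _ fun n => measurable_pi_apply _))
  · have ht := hX.memLp_two t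
    have h0 := hX.memLp_two t₀
    have h01 : cov[X t₀, X t₀; P] = 1 := by rw [covariance_self h0.aemeasurable, h1]
    unfold residual
    rw [covariance_const_mul_right, covariance_fun_sub_right h0 ht (h0.const_mul _),
      covariance_const_mul_right, h01, covariance_comm]
    ring

theorem pathEval_eq_path {F : C(T, ℝ) → ℝ} {ω : Ω} (h : Continuous fun t => X t ω) :
    pathEval F (fun t => X t ω) = F (path X ω) := by
  rw [path_eq h, pathEval, dif_pos h]

/-- Almost surely the path is X(t₀) r + Z/g; by independence the joint law is a product, and Fubini
integrates out `Z` first. -/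
theorem measureReal_lt_pathEval_eq (hX : IsCenteredContinuous X P) (h1 : Var[X t₀; P] = 1)
    (hν : 0 < ν) (hg : 0 < g)
    (hinc : ∀ s t, g ^ 2 * Var[fun ω => X s ω - X t ω; P] ≤ κ * dist s t ^ ν)
    {F : C(T, ℝ) → ℝ} (hF : Continuous F) (r : C(T, ℝ)) (hr : ∀ t, r t = cov[X t, X t₀; P]) :
    P.real {ω | g < pathEval F fun t => X t ω} =
      ∫ x, (P.map (path (residual X P t₀ g))).real {w | g < F (x • r + g⁻¹ • w)}
        ∂(gaussianReal 0 1) := by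
  have hZ := isHolderGaussian_residual hX h1 hν hg hinc
  have hZm : AEMeasurable (path (residual X P t₀ g)) P :=
    hZ.toIsCenteredContinuous.aemeasurable_path
  have h0m : AEMeasurable (X t₀) P := hX.gaussian.aemeasurable t₀
  have : IsProbabilityMeasure (P.map (path (residual X P t₀ g))) :=
    Measure.isProbabilityMeasure_map hZm
  have hlaw : P.map (X t₀) = gaussianReal 0 1 := by
    rw [(hX.gaussian.hasGaussianLaw_eval t₀).map_eq_gaussianReal, hX.centered, h1]
    simp
  have hjoint := (indepFun_iff_map_prod_eq_prod_map_map h0m hZm).1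
    (indepFun_path_residual (g := g) hX h1)
  rw [hlaw] at hjoint
  set μ := P.map (path (residual X P t₀ g)) with hμ
  have hcont : Continuous fun q : ℝ × C(T, ℝ) => F (q.1 • r + g⁻¹ • q.2) := by fun_prop
  have hS : MeasurableSet {q : ℝ × C(T, ℝ) | g < F (q.1 • r + g⁻¹ • q.2)} :=
    measurableSet_lt measurable_const hcont.measurable
  have hae : {ω | g < pathEval F fun t => X t ω} =ᵐ[P]
      (fun ω => (X t₀ ω, path (residual X P t₀ g) ω)) ⁻¹'
        {q : ℝ × C(T, ℝ) | g < F (q.1 • r + g⁻¹ • q.2)} := by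
    filter_upwards [hX.continuous_paths, hX.ae_path_eq, hZ.toIsCenteredContinuous.ae_path_eq]
      with ω hω hω1 hω2
    have hdec : X t₀ ω • r + g⁻¹ • path (residual X P t₀ g) ω = path X ω := by
      ext t
      simp only [ContinuousMap.add_apply, ContinuousMap.smul_apply, smul_eq_mul, hr, hω1, hω2,
        residual]
      field_simp
      ring
    have : (g < pathEval F fun t => X t ω) ↔
        g < F (X t₀ ω • r + g⁻¹ • path (residual X P t₀ g) ω) := by
      rw [pathEval_eq_path hω, hdec]
    exact propext this
  rw [measureReal_congr hae, ← map_measureReal_apply_of_aemeasurable (h0m.prodMk hZm) hS, hjoint,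
    Measure.real, Measure.prod_apply hS]
  exact (integral_toReal (measurable_measure_prodMk_left hS).aemeasurable
    (ae_of_all _ fun x => measure_lt_top _ _)).symm

/-- Conditioning on the value at the base point, and rescaling. -/
theorem measureReal_lt_pathEval_eq_rescaled (hX : IsCenteredContinuous X P)
    (h1 : Var[X t₀; P] = 1) (hν : 0 < ν) (hg : 0 < g)
    (hinc : ∀ s t, g ^ 2 * Var[fun ω => X s ω - X t ω; P] ≤ κ * dist s t ^ ν)
    {F : C(T, ℝ) → ℝ} (hF : Continuous F)
    (hF2 : ∀ (f : C(T, ℝ)) (c b : ℝ), 0 < c → F (c • f + ContinuousMap.const T b) = c * F f + b)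
    (m : C(T, ℝ)) (hm : ∀ t, m t = g ^ 2 * (cov[X t, X t₀; P] - 1)) :
    P.real {ω | g < pathEval F fun t => X t ω} = gaussianPDFReal 0 1 g / g *
      ∫ y, Real.exp (y - y ^ 2 / (2 * g ^ 2)) *
        (P.map (path (residual X P t₀ g))).real {w | y < F (m - (y / g ^ 2) • m + w)} := by
  set r : C(T, ℝ) := ContinuousMap.const T 1 + (g ^ 2)⁻¹ • m with hrdef
  have hr : ∀ t, r t = cov[X t, X t₀; P] := by
    intro t
    simp only [hrdef, ContinuousMap.add_apply, ContinuousMap.const_apply, ContinuousMap.smul_apply,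
      hm, smul_eq_mul]
    field_simp
    ring
  rw [measureReal_lt_pathEval_eq hX h1 hν hg hinc hF r hr, integral_gaussianReal_eq_rescaled _ hg]
  have hset : ∀ y, {w : C(T, ℝ) | g < F ((g - y / g) • r + g⁻¹ • w)} =
      {w | y < F (m - (y / g ^ 2) • m + w)} := by
    intro y
    ext w
    -- Since r = 1 + m/g², the path is a positive multiple of a rescaled path plus a constant, the
    -- form to which `hF2` applies.
    have hrw : (g - y / g) • r + g⁻¹ • w =
        g⁻¹ • (m - (y / g ^ 2) • m + w) + ContinuousMap.const T (g - y / g) := by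
      ext t
      simp only [hrdef, ContinuousMap.add_apply, ContinuousMap.sub_apply,
        ContinuousMap.const_apply, ContinuousMap.smul_apply, smul_eq_mul]
      field_simp
      ring
    change g < F _ ↔ y < F _
    rw [hrw, hF2 _ _ _ (inv_pos.2 hg)]
    constructor
    · intro h
      have h2 : g⁻¹ * y < g⁻¹ * F (m - (y / g ^ 2) • m + w) := by
        rw [← div_eq_inv_mul]; linarith
      exact lt_of_mul_lt_mul_left h2 (inv_pos.2 hg).le
    · intro h
      have h2 := mul_lt_mul_of_pos_left h (inv_pos.2 hg)
      rw [← div_eq_inv_mul] at h2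
      linarith
  simp_rw [hset]

end Conditioning

/-! ### Two consequences of convergence in distribution -/

/-- Against an `L`-Lipschitz test function, replacing `c k` by `c₀` costs at most L‖c₀ - c k‖. -/
theorem tendstoInDistribution_const_add {E : Type*} [NormedAddCommGroup E] [MeasurableSpace E]
    [BorelSpace E] {Ω : ℕ → Type*} [∀ k, MeasurableSpace (Ω k)] {P : ∀ k, Measure (Ω k)}
    [∀ k, IsProbabilityMeasure (P k)] {X : ∀ k, Ω k → E} {Ω' : Type*} [MeasurableSpace Ω']
    {Q : Measure Ω'} [IsProbabilityMeasure Q] {Y : Ω' → E}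
    (h : TendstoInDistribution X atTop Y P Q) {c : ℕ → E} {c₀ : E}
    (hc : Tendsto c atTop (𝓝 c₀)) :
    TendstoInDistribution (fun k ω => c k + X k ω) atTop (fun ω => c₀ + Y ω) P Q := by
  have hadd : ∀ a : E, Measurable fun x : E => a + x := fun a => (continuous_const_add a).measurable
  refine ⟨fun k => (hadd _).comp_aemeasurable (h.forall_aemeasurable k),
    (hadd _).comp_aemeasurable h.aemeasurable_limit, ?_⟩
  refine tendsto_iff_forall_lipschitz_integral_tendsto.2 ?_
  rintro f ⟨b, hb⟩ ⟨L, hL⟩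
  have h0 := tendsto_iff_forall_lipschitz_integral_tendsto.1
    (h.continuous_comp (continuous_const_add c₀)).tendsto f ⟨b, hb⟩ ⟨L, hL⟩
  simp only [ProbabilityMeasure.coe_mk] at h0 ⊢
  rw [integral_map (h.continuous_comp (continuous_const_add c₀)).aemeasurable_limit
    hL.continuous.aestronglyMeasurable] at h0
  simp_rw [fun k => integral_map
    ((h.continuous_comp (continuous_const_add c₀)).forall_aemeasurable k)
    hL.continuous.aestronglyMeasurable] at h0
  have hY : AEMeasurable (fun ω => c₀ + Y ω) Q := (hadd _).comp_aemeasurable h.aemeasurable_limit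
  have hX : ∀ k, AEMeasurable (fun ω => c k + X k ω) (P k) := fun k =>
    (hadd _).comp_aemeasurable (h.forall_aemeasurable k)
  rw [integral_map hY hL.continuous.aestronglyMeasurable]
  simp_rw [fun k => integral_map (hX k) hL.continuous.aestronglyMeasurable]
  refine h0.congr_dist ?_
  have hlim : Tendsto (fun k => L * ‖c₀ - c k‖) atTop (𝓝 0) := by
    have := (hc.const_sub c₀).norm.const_mul (L : ℝ)
    simpa using this
  refine squeeze_zero (fun _ => dist_nonneg) (fun k => ?_) hlim
  have hint : ∀ a : E, Integrable (fun ω => f (a + X k ω)) (P k) := fun a =>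
    Integrable.of_bound (hL.continuous.measurable.comp_aemeasurable
      ((hadd a).comp_aemeasurable (h.forall_aemeasurable k))).aestronglyMeasurable (|f 0| + b)
      (ae_of_all _ fun ω => by
        have h1 := hb (a + X k ω) 0
        rw [Real.dist_eq] at h1
        have h2 := abs_sub_abs_le_abs_sub (f (a + X k ω)) (f 0)
        rw [Real.norm_eq_abs]
        linarith)
  rw [Real.dist_eq]
  simp only [Function.comp_apply]
  rw [← integral_sub (hint c₀) (hint (c k))]
  have := norm_integral_le_of_norm_le_const (μ := P k) (f := fun ω => f (c₀ + X k ω) - f (c k + X k ω))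
    (C := L * ‖c₀ - c k‖) (ae_of_all _ fun ω => by
      have h3 := hL.dist_le_mul (c₀ + X k ω) (c k + X k ω)
      rwa [dist_add_right, dist_eq_norm, dist_eq_norm] at h3)
  simpa using this

/-- Portmanteau applies wherever `V` has no atom, that is, outside a countable set. The variables
may depend on `y`, as the rescaled drift does. -/
theorem ae_tendsto_measureReal_lt {Ω : ℕ → Type*} [∀ k, MeasurableSpace (Ω k)]
    {P : ∀ k, Measure (Ω k)} [∀ k, IsProbabilityMeasure (P k)]
    {Ω' : Type*} [MeasurableSpace Ω'] {Q : Measure Ω'} [IsProbabilityMeasure Q] {V : Ω' → ℝ}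
    {U : ℝ → ∀ k, Ω k → ℝ} (h : ∀ y, TendstoInDistribution (U y) atTop V P Q) :
    ∀ᵐ y, Tendsto (fun k => (P k).real {ω | y < U y k ω}) atTop (𝓝 (Q.real {ω | y < V ω})) := by
  have hV : AEMeasurable V Q := (h 0).aemeasurable_limit
  have : IsProbabilityMeasure (Q.map V) := Measure.isProbabilityMeasure_map hV
  have hcount : Set.Countable {y : ℝ | 0 < Q.map V {y}} :=
    Measure.countable_meas_pos_of_disjoint_iUnion (fun y => measurableSet_singleton y)
      fun a b hab => by simpa [Function.onFun] using hab
  filter_upwards [hcount.ae_notMem volume] with y hy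
  have hy0 : Q.map V {y} = 0 := by simpa using hy
  have h1 : Tendsto (fun k => (P k).map (U y k) (Set.Ioi y)) atTop (𝓝 (Q.map V (Set.Ioi y))) :=
    ProbabilityMeasure.tendsto_measure_of_null_frontier_of_tendsto' (h y).tendsto
      (E := Set.Ioi y) (by simpa [frontier_Ioi] using hy0)
  rw [Measure.map_apply_of_aemeasurable hV measurableSet_Ioi] at h1
  exact (ENNReal.tendsto_toReal (measure_ne_top _ _)).comp (h1.congr fun k =>
    Measure.map_apply_of_aemeasurable ((h y).forall_aemeasurable k) measurableSet_Ioi)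

/-! ### Local structure along a sequence of levels -/

/-- The assumptions of the asymptotic theorem along a sequence of levels `g k`, in terms of the
limiting field `ζ` and the limiting drift `δ`. -/
structure LocalStructure {T : Type*} [PseudoMetricSpace T] (t₀ : T) {Ω : ℕ → Type*}
    [∀ k, MeasurableSpace (Ω k)] (X : ∀ k, T → Ω k → ℝ) (P : ∀ k, Measure (Ω k)) {Ω' : Type*}
    [MeasurableSpace Ω'] (ζ : T → Ω' → ℝ) (Q : Measure Ω') (δ : T → ℝ) (g : ℕ → ℝ)
    (κ ν : ℝ) : Prop where
  field : ∀ k, IsCenteredContinuous (X k) (P k)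
  limit : IsCenteredContinuous ζ Q
  limit_base : ∀ᵐ ω ∂Q, ζ t₀ ω = 0
  level_pos : ∀ k, 0 < g k
  level_tendsto : Tendsto g atTop atTop
  exponent_pos : 0 < ν
  constant_nonneg : 0 ≤ κ
  variance_base : ∀ k, Var[X k t₀; P k] = 1
  variance_tendsto : TendstoUniformly (fun k t => g k ^ 2 * (1 - Var[X k t; P k]))
    (fun t => 2 * δ t) atTop
  increment_tendsto : ∀ s t, Tendsto (fun k => g k ^ 2 * Var[fun ω => X k s ω - X k t ω; P k]) atTop
    (𝓝 (2 * Var[fun ω => ζ s ω - ζ t ω; Q]))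
  increment_le : ∀ k s t, g k ^ 2 * Var[fun ω => X k s ω - X k t ω; P k] ≤ κ * dist s t ^ ν

namespace LocalStructure

variable {T : Type*} [MetricSpace T] [CompactSpace T] {t₀ : T} {Ω : ℕ → Type*}
  [∀ k, MeasurableSpace (Ω k)] {X : ∀ k, T → Ω k → ℝ} {P : ∀ k, Measure (Ω k)}
  [∀ k, IsProbabilityMeasure (P k)] {Ω' : Type*} [MeasurableSpace Ω'] {ζ : T → Ω' → ℝ}
  {Q : Measure Ω'} [IsProbabilityMeasure Q] {δ : T → ℝ} {g : ℕ → ℝ} {κ ν : ℝ}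

theorem variance_limit_sub_base (h : LocalStructure t₀ X P ζ Q δ g κ ν) (t : T) :
    Var[fun ω => ζ t ω - ζ t₀ ω; Q] = Var[ζ t; Q] := by
  refine variance_congr ?_
  filter_upwards [h.limit_base] with ω hω
  rw [hω, sub_zero]

/-- With A = X(s) - X(t₀) and B = X(t) - X(t₀), Var A - Var B = cov(A - B, A + B), and
Cauchy–Schwarz applies. This gives a modulus of continuity common to all `k`. -/
theorem sq_sub_le (h : LocalStructure t₀ X P ζ Q δ g κ ν) (k : ℕ) (s t : T) :
    (g k ^ 2 * Var[fun ω => X k s ω - X k t₀ ω; P k] -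
      g k ^ 2 * Var[fun ω => X k t ω - X k t₀ ω; P k]) ^ 2 ≤
      (4 * κ * Metric.diam (Set.univ : Set T) ^ ν) * (κ * dist s t ^ ν) := by
  have hm := (h.field k).memLp_two
  have hA : MemLp (fun ω => X k s ω - X k t₀ ω) 2 (P k) := (hm s).sub (hm t₀)
  have hB : MemLp (fun ω => X k t ω - X k t₀ ω) 2 (P k) := (hm t).sub (hm t₀)
  have hdiff : (fun ω => X k s ω - X k t ω) =
      fun ω => (X k s ω - X k t₀ ω) - (X k t ω - X k t₀ ω) := by ext ω; ring
  set A := fun ω => X k s ω - X k t₀ ω with hAdef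
  set B := fun ω => X k t ω - X k t₀ ω with hBdef
  have hcs := covariance_sq_le (hA.sub hB) (hA.add hB)
  have hcov : cov[A - B, A + B; P k] = Var[A; P k] - Var[B; P k] := by
    rw [covariance_add_right (hA.sub hB) hA hB, covariance_sub_left hA hB hA,
      covariance_sub_left hA hB hB, covariance_self hA.aemeasurable,
      covariance_self hB.aemeasurable, covariance_comm B A]
    ring
  have hsum : Var[A + B; P k] ≤ 2 * Var[A; P k] + 2 * Var[B; P k] := by
    have h1 := variance_nonneg (A - B) (P k)
    rw [variance_sub hA hB] at h1
    rw [variance_add hA hB]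
    linarith
  have hdiam : ∀ x y : T, κ * dist x y ^ ν ≤ κ * Metric.diam (Set.univ : Set T) ^ ν := fun x y =>
    mul_le_mul_of_nonneg_left (Real.rpow_le_rpow dist_nonneg
      (Metric.dist_le_diam_of_mem isCompact_univ.isBounded trivial trivial)
      h.exponent_pos.le) h.constant_nonneg
  have hgA := (h.increment_le k s t₀).trans (hdiam s t₀)
  have hgB := (h.increment_le k t t₀).trans (hdiam t t₀)
  have hgD := h.increment_le k s t
  rw [hdiff] at hgD
  change g k ^ 2 * Var[A - B; P k] ≤ _ at hgD
  rw [hcov] at hcs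
  have hg2 : 0 ≤ g k ^ 2 := sq_nonneg _
  have hgS : g k ^ 2 * Var[A + B; P k] ≤ 4 * κ * Metric.diam (Set.univ : Set T) ^ ν := by
    have := mul_le_mul_of_nonneg_left hsum hg2
    linarith
  calc (g k ^ 2 * Var[A; P k] - g k ^ 2 * Var[B; P k]) ^ 2
      = g k ^ 2 * g k ^ 2 * (Var[A; P k] - Var[B; P k]) ^ 2 := by ring
    _ ≤ g k ^ 2 * g k ^ 2 * (Var[A - B; P k] * Var[A + B; P k]) :=
        mul_le_mul_of_nonneg_left hcs (by positivity)
    _ = (g k ^ 2 * Var[A + B; P k]) * (g k ^ 2 * Var[A - B; P k]) := by ring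
    _ ≤ _ := mul_le_mul hgS hgD (mul_nonneg hg2 (variance_nonneg _ _))
        ((mul_nonneg hg2 (variance_nonneg _ _)).trans hgS)

/-- On a compact space, equicontinuity upgrades the pointwise convergence to uniform convergence. -/
theorem tendstoUniformly_increment (h : LocalStructure t₀ X P ζ Q δ g κ ν) :
    TendstoUniformly (fun k t => g k ^ 2 * Var[fun ω => X k t ω - X k t₀ ω; P k])
      (fun t => 2 * Var[ζ t; Q]) atTop := by
  have heq : Equicontinuous (fun k t => g k ^ 2 * Var[fun ω => X k t ω - X k t₀ ω; P k]) := by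
    refine Metric.equicontinuous_of_continuity_modulus
      (fun r => √((4 * κ * Metric.diam (Set.univ : Set T) ^ ν) * (κ * r ^ ν))) ?_ _
      fun s t k => ?_
    · have hc : ContinuousAt (fun r : ℝ =>
          √((4 * κ * Metric.diam (Set.univ : Set T) ^ ν) * (κ * r ^ ν))) 0 :=
        ((((continuousAt_id.rpow_const (Or.inr h.exponent_pos.le)).const_mul κ).const_mul _)).sqrt
      simpa [ContinuousAt, Real.zero_rpow h.exponent_pos.ne'] using hc
    · rw [Real.dist_eq]
      exact Real.abs_le_sqrt (h.sq_sub_le k s t)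
  have := (heq.tendsto_uniformFun_iff_pi atTop (fun t => 2 * Var[ζ t; Q])).2
    (tendsto_pi_nhds.2 fun t => by
      have := h.increment_tendsto t t₀
      rwa [h.variance_limit_sub_base] at this)
  exact UniformFun.tendsto_iff_tendstoUniformly.1 this

/-- The rescaled conditional mean of the field, recentred at the level. -/
noncomputable def drift (h : LocalStructure t₀ X P ζ Q δ g κ ν) (k : ℕ) : C(T, ℝ) :=
  ⟨fun t => g k ^ 2 * (cov[X k t, X k t₀; P k] - 1),
    ((continuous_covariance_base (h.field k) (h.variance_base k) h.exponent_pos (h.level_pos k)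
      (h.increment_le k)).sub continuous_const).const_mul _⟩

theorem drift_apply (h : LocalStructure t₀ X P ζ Q δ g κ ν) (k : ℕ) (t : T) :
    h.drift k t = g k ^ 2 * (cov[X k t, X k t₀; P k] - 1) := rfl

theorem drift_eq (h : LocalStructure t₀ X P ζ Q δ g κ ν) (k : ℕ) (t : T) :
    h.drift k t = -(1 / 2) * (g k ^ 2 * (1 - Var[X k t; P k])) +
      -(1 / 2) * (g k ^ 2 * Var[fun ω => X k t ω - X k t₀ ω; P k]) := by
  rw [h.drift_apply, variance_fun_sub ((h.field k).memLp_two t) ((h.field k).memLp_two t₀),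
    h.variance_base]
  ring

/-- Both terms of `drift_eq` converge uniformly. The limit is continuous as a uniform limit of
continuous functions; no continuity of `δ` is assumed. -/
theorem exists_tendsto_drift (h : LocalStructure t₀ X P ζ Q δ g κ ν) :
    ∃ m : C(T, ℝ), (∀ t, m t = -Var[ζ t; Q] - δ t) ∧ Tendsto h.drift atTop (𝓝 m) := by
  have hu : TendstoUniformly (fun k t => h.drift k t) (fun t => -Var[ζ t; Q] - δ t) atTop := by
    have hlin : UniformContinuous fun x : ℝ => -(1 / 2) * x :=
      uniformContinuous_const_smul (-(1 / 2) : ℝ)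
    have h1 := hlin.comp_tendstoUniformly h.variance_tendsto
    have h2 := hlin.comp_tendstoUniformly h.tendstoUniformly_increment
    have h3 := h1.add h2
    have hlim : (fun t => -Var[ζ t; Q] - δ t) = (fun x : ℝ => -(1 / 2) * x) ∘ (fun t => 2 * δ t) +
        (fun x : ℝ => -(1 / 2) * x) ∘ fun t => 2 * Var[ζ t; Q] := by
      ext t
      simp only [Pi.add_apply, Function.comp_apply]
      ring
    have hdrift : (fun k t => h.drift k t) =
        (fun k => (fun x : ℝ => -(1 / 2) * x) ∘ fun t => g k ^ 2 * (1 - Var[X k t; P k])) +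
        fun k => (fun x : ℝ => -(1 / 2) * x) ∘
          fun t => g k ^ 2 * Var[fun ω => X k t ω - X k t₀ ω; P k] := by
      ext k t
      exact h.drift_eq k t
    rw [hlim, hdrift]
    exact h3
  have hc : Continuous fun t => -Var[ζ t; Q] - δ t :=
    hu.continuous (Frequently.of_forall fun k => (h.drift k).continuous)
  exact ⟨⟨_, hc⟩, fun t => rfl, ContinuousMap.tendsto_iff_tendstoUniformly.2 hu⟩

theorem variance_tendsto_apply (h : LocalStructure t₀ X P ζ Q δ g κ ν) (t : T) :
    Tendsto (fun k => g k ^ 2 * (1 - Var[X k t; P k])) atTop (𝓝 (2 * δ t)) :=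
  h.variance_tendsto.tendsto_at t

/-- Expand with r = 1 + m/g². The product of the two drifts carries a factor g⁻² and disappears, and
the contributions of `δ` cancel in the limit. -/
theorem covariance_residual_tendsto (h : LocalStructure t₀ X P ζ Q δ g κ ν) (s t : T) :
    Tendsto (fun k => cov[residual (X k) (P k) t₀ (g k) s, residual (X k) (P k) t₀ (g k) t; P k])
      atTop (𝓝 cov[fun ω => √2 * ζ s ω, fun ω => √2 * ζ t ω; Q]) := by
  obtain ⟨m, hm, hlim⟩ := h.exists_tendsto_drift
  have hmt : ∀ t, Tendsto (fun k => h.drift k t) atTop (𝓝 (-Var[ζ t; Q] - δ t)) := fun t => by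
    rw [← hm]
    exact ((continuous_eval_const t).tendsto m).comp hlim
  have hginv : Tendsto (fun k => (g k ^ 2)⁻¹) atTop (𝓝 0) :=
    ((tendsto_pow_atTop two_ne_zero).comp h.level_tendsto).inv_tendsto_atTop
  have hform : ∀ k, cov[residual (X k) (P k) t₀ (g k) s, residual (X k) (P k) t₀ (g k) t; P k] =
      -(1 / 2) * (g k ^ 2 * (1 - Var[X k s; P k])) + -(1 / 2) * (g k ^ 2 * (1 - Var[X k t; P k])) +
      -(1 / 2) * (g k ^ 2 * Var[fun ω => X k s ω - X k t ω; P k]) - h.drift k s - h.drift k t -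
      h.drift k s * h.drift k t * (g k ^ 2)⁻¹ := by
    intro k
    have hg := h.level_pos k
    rw [covariance_residual (h.field k) (h.variance_base k),
      variance_fun_sub ((h.field k).memLp_two s) ((h.field k).memLp_two t),
      h.drift_apply, h.drift_apply]
    field_simp
    ring
  simp_rw [hform]
  have hfin : cov[fun ω => √2 * ζ s ω, fun ω => √2 * ζ t ω; Q] =
      -(1 / 2) * (2 * δ s) + -(1 / 2) * (2 * δ t) +
      -(1 / 2) * (2 * Var[fun ω => ζ s ω - ζ t ω; Q]) - (-Var[ζ s; Q] - δ s) -
      (-Var[ζ t; Q] - δ t) - (-Var[ζ s; Q] - δ s) * (-Var[ζ t; Q] - δ t) * 0 := by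
    rw [covariance_const_mul_left, covariance_const_mul_right, ← mul_assoc,
      Real.mul_self_sqrt zero_le_two,
      variance_fun_sub (h.limit.memLp_two s) (h.limit.memLp_two t)]
    ring
  rw [hfin]
  exact ((((((h.variance_tendsto_apply s).const_mul _).add
    ((h.variance_tendsto_apply t).const_mul _)).add
    ((h.increment_tendsto s t).const_mul _)).sub (hmt s)).sub (hmt t)).sub
    (((hmt s).mul (hmt t)).mul hginv)

theorem isHolderGaussian_limit (h : LocalStructure t₀ X P ζ Q δ g κ ν) :
    IsHolderGaussian (fun t ω => √2 * ζ t ω) Q κ ν where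
  gaussian := h.limit.gaussian.smul fun _ => √2
  centered t := by rw [integral_const_mul, h.limit.centered, mul_zero]
  continuous_paths := h.limit.continuous_paths.mono fun ω hω => hω.const_mul _
  variance_sub_le s t := by
    simp_rw [← mul_sub]
    rw [variance_const_mul, Real.sq_sqrt zero_le_two]
    exact le_of_tendsto' (h.increment_tendsto s t) fun k => h.increment_le k s t

theorem isHolderGaussian_residual (h : LocalStructure t₀ X P ζ Q δ g κ ν) (k : ℕ) :
    IsHolderGaussian (residual (X k) (P k) t₀ (g k)) (P k) κ ν :=
  GaussianField.isHolderGaussian_residual (h.field k) (h.variance_base k) h.exponent_pos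
    (h.level_pos k) (h.increment_le k)

variable [Nonempty T] [MeasurableSpace C(T, ℝ)] [BorelSpace C(T, ℝ)]

theorem tendstoInDistribution_residual (h : LocalStructure t₀ X P ζ Q δ g κ ν)
    (N : DyadicNets T t₀) :
    TendstoInDistribution (fun k => path (residual (X k) (P k) t₀ (g k))) atTop
      (path fun t ω => √2 * ζ t ω) P Q := by
  refine tendstoInDistribution_path (fun k => (h.isHolderGaussian_residual k).toIsCenteredContinuous)
    h.isHolderGaussian_limit.toIsCenteredContinuous h.covariance_residual_tendsto fun ε hε => ?_
  -- The bound is taken twice because the spaces `Ω k` and `Ω'` may live in different universes.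
  obtain ⟨δ₁, hδ₁, h₁⟩ := N.exists_measure_modulus_le h.constant_nonneg h.exponent_pos hε
  obtain ⟨δ₂, hδ₂, h₂⟩ := N.exists_measure_modulus_le h.constant_nonneg h.exponent_pos hε
  refine ⟨min δ₁ δ₂, lt_min hδ₁ hδ₂, fun k => ?_, ?_⟩
  · refine (measure_mono ?_).trans (h₁ (P k) _ (h.isHolderGaussian_residual k))
    rintro ω ⟨s, t, hst, h3⟩
    exact ⟨s, t, hst.trans (min_le_left _ _), h3⟩
  · refine (measure_mono ?_).trans (h₂ Q _ h.isHolderGaussian_limit)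
    rintro ω ⟨s, t, hst, h3⟩
    exact ⟨s, t, hst.trans (min_le_right _ _), h3⟩

theorem exists_measureReal_norm_le (h : LocalStructure t₀ X P ζ Q δ g κ ν)
    (N : DyadicNets T t₀) :
    ∃ B C : ℝ, 0 ≤ C ∧ ∀ k, ∀ x, 0 ≤ x →
      ((P k).map (path (residual (X k) (P k) t₀ (g k)))).real {w | B + x < ‖w‖} ≤
        C * Real.exp (-4 * x) := by
  obtain ⟨B, C, hC, hBC⟩ := N.exists_measure_sup_le h.constant_nonneg h.exponent_pos four_pos
  refine ⟨max B 0, C, hC, fun k x hx => ?_⟩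
  have hZ := h.isHolderGaussian_residual k
  have hZm := hZ.toIsCenteredContinuous.aemeasurable_path
  rw [map_measureReal_apply_of_aemeasurable hZm (measurableSet_lt measurable_const measurable_norm)]
  refine ENNReal.toReal_le_of_le_ofReal (by positivity) ?_
  refine (measure_mono_ae ?_).trans (hBC (P k) _ hZ x hx)
  filter_upwards [hZ.toIsCenteredContinuous.ae_path_eq] with ω hω hlt
  have hlt' : max B 0 + x < ‖path (residual (X k) (P k) t₀ (g k)) ω‖ := hlt
  by_contra hcon
  refine absurd hlt' (not_lt.2 ?_)
  rw [ContinuousMap.norm_le _ (add_nonneg (le_max_right _ _) hx)]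
  intro t
  have h0 : residual (X k) (P k) t₀ (g k) t₀ ω = 0 := by
    have h01 : cov[X k t₀, X k t₀; P k] = 1 := by
      rw [covariance_self ((h.field k).memLp_two t₀).aemeasurable, h.variance_base]
    simp [residual, h01]
  have h1 : ¬ B + x < |residual (X k) (P k) t₀ (g k) t ω - residual (X k) (P k) t₀ (g k) t₀ ω| :=
    fun h2 => hcon ⟨t, h2⟩
  rw [h0, sub_zero, not_lt] at h1
  rw [hω, Real.norm_eq_abs]
  exact h1.trans (by gcongr; exact le_max_left _ _)

theorem exists_measureReal_le (h : LocalStructure t₀ X P ζ Q δ g κ ν)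
    (N : DyadicNets T t₀) {F : C(T, ℝ) → ℝ} (hF1 : ∀ f, |F f| ≤ ‖f‖) :
    ∃ K : ℝ, ∀ᶠ k in atTop, ∀ y, 0 < y →
      ((P k).map (path (residual (X k) (P k) t₀ (g k)))).real
        {w | y < F (h.drift k - (y / g k ^ 2) • h.drift k + w)} ≤ K * Real.exp (-2 * y) := by
  obtain ⟨B, C, hC, hBC⟩ := h.exists_measureReal_norm_le N
  obtain ⟨m, -, hm⟩ := h.exists_tendsto_drift
  have hbd : ∀ᶠ k in atTop, ‖h.drift k‖ ≤ ‖m‖ + 1 :=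
    (hm.norm.eventually (gt_mem_nhds (lt_add_one _))).mono fun k hk => le_of_lt hk
  have hlarge : ∀ᶠ k in atTop, 2 * (‖m‖ + 1) ≤ g k ^ 2 :=
    ((tendsto_pow_atTop two_ne_zero).comp h.level_tendsto).eventually (eventually_ge_atTop _)
  set M := ‖m‖ + 1 with hMdef
  have hM : 0 < M := by positivity
  -- The event forces ‖Z‖ > y/2 - M, so rate 4 for the norm becomes rate 2 in `y`. The maximum with
  -- 1 covers the small `y` for which only the trivial bound is available.
  refine ⟨max C 1 * Real.exp (4 * (M + B)), ?_⟩
  filter_upwards [hbd, hlarge] with k hk1 hk2 y hy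
  have hmP : IsProbabilityMeasure ((P k).map (path (residual (X k) (P k) t₀ (g k)))) :=
    Measure.isProbabilityMeasure_map
      (h.isHolderGaussian_residual k).toIsCenteredContinuous.aemeasurable_path
  have hsub : {w | y < F (h.drift k - (y / g k ^ 2) • h.drift k + w)} ⊆
      {w | B + (y / 2 - M - B) < ‖w‖} := by
    intro w hw
    have hw' : y < F (h.drift k - (y / g k ^ 2) • h.drift k + w) := hw
    have h1 := (le_abs_self _).trans (hF1 (h.drift k - (y / g k ^ 2) • h.drift k + w))
    have h2 := norm_add_le (h.drift k - (y / g k ^ 2) • h.drift k) w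
    have h3 := norm_sub_le (h.drift k) ((y / g k ^ 2) • h.drift k)
    have hg2 : 0 < g k ^ 2 := pow_pos (h.level_pos k) 2
    have h4 : ‖(y / g k ^ 2) • h.drift k‖ ≤ y / 2 := by
      rw [norm_smul, Real.norm_of_nonneg (by positivity), div_mul_eq_mul_div,
        div_le_div_iff₀ hg2 two_pos]
      nlinarith
    change B + (y / 2 - M - B) < ‖w‖
    linarith
  have hexp : max C 1 * Real.exp (4 * (M + B)) * Real.exp (-2 * y) =
      max C 1 * Real.exp (-4 * (y / 2 - M - B)) := by
    rw [mul_assoc, ← Real.exp_add]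
    congr 2
    ring
  rw [hexp]
  rcases le_or_gt 0 (y / 2 - M - B) with hx | hx
  · refine (measureReal_mono hsub).trans ((hBC k _ hx).trans ?_)
    gcongr
    exact le_max_left _ _
  · have h5 : 1 ≤ Real.exp (-4 * (y / 2 - M - B)) := Real.one_le_exp (by linarith)
    have h6 : 1 ≤ max C 1 := le_max_right _ _
    exact measureReal_le_one.trans (by nlinarith)

end LocalStructure

/-! ### The limit of the exceedance ratio -/

namespace LocalStructure

variable {T : Type*} [MetricSpace T] [CompactSpace T] {t₀ : T} {Ω : ℕ → Type*}
  [∀ k, MeasurableSpace (Ω k)] {X : ∀ k, T → Ω k → ℝ} {P : ∀ k, Measure (Ω k)}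
  [∀ k, IsProbabilityMeasure (P k)] {Ω' : Type*} [MeasurableSpace Ω'] {ζ : T → Ω' → ℝ}
  {Q : Measure Ω'} [IsProbabilityMeasure Q] {δ : T → ℝ} {g : ℕ → ℝ} {κ ν : ℝ}

theorem integrable_and_tendsto_ratio (h : LocalStructure t₀ X P ζ Q δ g κ ν)
    (N : DyadicNets T t₀) {F : C(T, ℝ) → ℝ} (hF : Continuous F) (hF1 : ∀ f, |F f| ≤ ‖f‖)
    (hF2 : ∀ (f : C(T, ℝ)) (c b : ℝ), 0 < c → F (c • f + ContinuousMap.const T b) = c * F f + b) :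
    Integrable (expFunctional F ζ δ Q) Q ∧
      Tendsto (fun k => (P k).real {ω | g k < pathEval F fun t => X k t ω} /
        (gaussianPDFReal 0 1 (g k) / g k)) atTop (𝓝 (piterbargConst F ζ δ Q)) := by
  have : Nonempty T := ⟨t₀⟩
  let : MeasurableSpace C(T, ℝ) := borel _
  have : BorelSpace C(T, ℝ) := ⟨rfl⟩
  obtain ⟨m, hm, hlim⟩ := h.exists_tendsto_drift
  obtain ⟨K, hK⟩ := h.exists_measureReal_le N hF1
  have hY := h.isHolderGaussian_limit.toIsCenteredContinuous
  have hYm := hY.aemeasurable_path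
  have hZm := fun k => (h.isHolderGaussian_residual k).toIsCenteredContinuous.aemeasurable_path
  have hμk : ∀ k, IsProbabilityMeasure ((P k).map (path (residual (X k) (P k) t₀ (g k)))) :=
    fun k => Measure.isProbabilityMeasure_map (hZm k)
  have hμ : IsProbabilityMeasure (Q.map (path fun t ω => √2 * ζ t ω)) :=
    Measure.isProbabilityMeasure_map hYm
  have hG : Continuous fun w : C(T, ℝ) => F (m + w) := by fun_prop
  have hset : MeasurableSet {q : ℝ × C(T, ℝ) | q.1 < F (m + q.2)} :=
    measurableSet_lt measurable_fst (hG.measurable.comp measurable_snd)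
  have hsetk : ∀ k, MeasurableSet
      {q : ℝ × C(T, ℝ) | q.1 < F (h.drift k - (q.1 / g k ^ 2) • h.drift k + q.2)} := by
    intro k
    have hc : Continuous fun q : ℝ × C(T, ℝ) =>
        F (h.drift k - (q.1 / g k ^ 2) • h.drift k + q.2) := by fun_prop
    exact measurableSet_lt measurable_fst hc.measurable
  have hae : ∀ᵐ y, Tendsto (fun k =>
      ((P k).map (path (residual (X k) (P k) t₀ (g k)))).real
        {w | y < F (h.drift k - (y / g k ^ 2) • h.drift k + w)}) atTop
      (𝓝 ((Q.map (path fun t ω => √2 * ζ t ω)).real {w | y < F (m + w)})) := by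
    have hdist : ∀ y : ℝ, TendstoInDistribution
        (fun k ω => F (h.drift k - (y / g k ^ 2) • h.drift k +
          path (residual (X k) (P k) t₀ (g k)) ω)) atTop
        (fun ω => F (m + path (fun t ω => √2 * ζ t ω) ω)) P Q := by
      intro y
      have hy : Tendsto (fun k => y / g k ^ 2) atTop (𝓝 0) :=
        tendsto_const_nhds.div_atTop ((tendsto_pow_atTop two_ne_zero).comp h.level_tendsto)
      have hc : Tendsto (fun k => h.drift k - (y / g k ^ 2) • h.drift k) atTop (𝓝 m) := by
        simpa using hlim.sub (hy.smul hlim)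
      exact (tendstoInDistribution_const_add (h.tendstoInDistribution_residual N) hc).continuous_comp
        hF
    filter_upwards [ae_tendsto_measureReal_lt hdist] with y hy
    have e1 : (Q.map (path fun t ω => √2 * ζ t ω)).real {w | y < F (m + w)} =
        Q.real {ω | y < F (m + path (fun t ω => √2 * ζ t ω) ω)} :=
      map_measureReal_apply_of_aemeasurable hYm (hset.preimage measurable_prodMk_left)
    rw [e1]
    exact hy.congr fun k => (map_measureReal_apply_of_aemeasurable (hZm k)
      ((hsetk k).preimage measurable_prodMk_left)).symm
  have hmain := tendsto_integral_exp_sub_sq h.level_tendsto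
    (fun k => (measurable_measure_prodMk_left (hsetk k)).ennreal_toReal)
    (fun k y => measureReal_nonneg) (fun k y => measureReal_le_one) hK hae
  have htail := integral_exp_mul_tail hG.measurable hmain.1
  have hexp : expFunctional F ζ δ Q =ᵐ[Q]
      fun ω => Real.exp (F (m + path (fun t ω => √2 * ζ t ω) ω)) := by
    filter_upwards [hY.ae_path_eq] with ω hω
    have hfun : (fun t => √2 * ζ t ω - Var[ζ t; Q] - δ t) =
        ⇑(m + path (fun t ω => √2 * ζ t ω) ω) := by
      ext t
      rw [ContinuousMap.add_apply, hm, hω]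
      ring
    rw [expFunctional, hfun, pathEval_coe]
  have hexpm : AEStronglyMeasurable (fun w => Real.exp (F (m + w)))
      (Q.map (path fun t ω => √2 * ζ t ω)) :=
    (Real.continuous_exp.comp hG).aestronglyMeasurable
  refine ⟨((integrable_map_measure hexpm hYm).1 htail.1).congr hexp.symm, ?_⟩
  have hconst : piterbargConst F ζ δ Q =
      ∫ y, Real.exp y * (Q.map (path fun t ω => √2 * ζ t ω)).real {w | y < F (m + w)} := by
    rw [piterbargConst, integral_congr_ae hexp, ← htail.2, integral_map hYm hexpm]
  rw [hconst]
  refine hmain.2.congr fun k => ?_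
  have hpos : 0 < gaussianPDFReal 0 1 (g k) / g k :=
    div_pos (gaussianPDFReal_pos _ _ _ one_ne_zero) (h.level_pos k)
  rw [eq_div_iff hpos.ne', measureReal_lt_pathEval_eq_rescaled (h.field k) (h.variance_base k)
    h.exponent_pos (h.level_pos k) (h.increment_le k) hF hF2 (h.drift k) (h.drift_apply k),
    mul_comm]
  rfl

end LocalStructure

/-! ### From the original hypotheses to the asymptotics -/

/-- Factor 1 - σ² = 2(1 - σ) - (1 - σ)². As `d` is bounded, the square is of order u⁻⁴ uniformly and
vanishes after multiplication by g², which is of order u². -/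
theorem tendstoUniformly_one_sub_sq {T : Type*} [Nonempty T] {σ : ℕ → T → ℝ} {d : T → ℝ}
    {M a : ℝ} (hM : ∀ t, |d t| ≤ M) {u g : ℕ → ℝ} (hu : Tendsto u atTop atTop)
    (hu0 : ∀ k, 0 < u k) (hga : Tendsto (fun k => g k / u k) atTop (𝓝 a))
    (h : TendstoUniformly (fun k t => u k ^ 2 * (1 - σ k t)) d atTop) :
    TendstoUniformly (fun k t => g k ^ 2 * (1 - σ k t ^ 2)) (fun t => 2 * (a ^ 2 * d t)) atTop := by
  obtain ⟨t₁⟩ := ‹Nonempty T›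
  have hM0 : 0 ≤ M := (abs_nonneg _).trans (hM t₁)
  have hb : Tendsto (fun k => (g k / u k) ^ 2) atTop (𝓝 (a ^ 2)) := hga.pow 2
  have hc : Tendsto (fun k => (g k / u k) ^ 2 / u k ^ 2) atTop (𝓝 0) :=
    hb.div_atTop ((tendsto_pow_atTop two_ne_zero).comp hu)
  have hb' : Tendsto (fun k => 2 * (M + 1) * |(g k / u k) ^ 2 - a ^ 2|) atTop (𝓝 0) := by
    have := ((hb.sub_const (a ^ 2)).abs).const_mul (2 * (M + 1))
    rwa [sub_self, abs_zero, mul_zero] at this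
  have hc' : Tendsto (fun k => (M + 1) ^ 2 * |(g k / u k) ^ 2 / u k ^ 2|) atTop (𝓝 0) := by
    simpa using hc.abs.const_mul ((M + 1) ^ 2)
  rw [Metric.tendstoUniformly_iff] at h ⊢
  intro ε hε
  filter_upwards [h (min 1 (ε / (3 * (2 * a ^ 2 + 1)))) (by positivity),
    hb'.eventually (gt_mem_nhds (by positivity : 0 < ε / 3)),
    hc'.eventually (gt_mem_nhds (by positivity : 0 < ε / 3))] with k h1 h2 h3 t
  have huk := hu0 k
  set A := u k ^ 2 * (1 - σ k t) with hA
  set b := (g k / u k) ^ 2 with hbdef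
  set c := b / u k ^ 2 with hcdef
  have hd := h1 t
  rw [Real.dist_eq] at hd
  have hd1 : |d t - A| < 1 := hd.trans_le (min_le_left _ _)
  have hd2 : |d t - A| < ε / (3 * (2 * a ^ 2 + 1)) := hd.trans_le (min_le_right _ _)
  have hAM : |A| ≤ M + 1 := by
    have e1 := abs_sub_abs_le_abs_sub A (d t)
    rw [abs_sub_comm] at e1
    linarith [hM t]
  have hform : 2 * (a ^ 2 * d t) - g k ^ 2 * (1 - σ k t ^ 2) =
      2 * a ^ 2 * (d t - A) - 2 * A * (b - a ^ 2) + A ^ 2 * c := by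
    have : g k ^ 2 * (1 - σ k t ^ 2) = 2 * A * b - A ^ 2 * c := by
      rw [hcdef, hbdef, hA]
      field_simp
      ring
    rw [this]
    ring
  rw [Real.dist_eq, hform]
  have t1 : |2 * a ^ 2 * (d t - A)| ≤ ε / 3 := by
    rw [abs_mul, abs_of_nonneg (by positivity)]
    calc 2 * a ^ 2 * |d t - A| ≤ (2 * a ^ 2 + 1) * (ε / (3 * (2 * a ^ 2 + 1))) := by
          gcongr
          linarith
      _ = ε / 3 := by field_simp
  have t2 : |2 * A * (b - a ^ 2)| < ε / 3 := by
    refine lt_of_le_of_lt ?_ h2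
    rw [abs_mul, abs_mul, abs_two]
    gcongr
  have t3 : |A ^ 2 * c| < ε / 3 := by
    refine lt_of_le_of_lt ?_ h3
    rw [abs_mul, abs_pow]
    gcongr
  calc _ ≤ |2 * a ^ 2 * (d t - A)| + |2 * A * (b - a ^ 2)| + |A ^ 2 * c| :=
        (abs_add_le _ _).trans (add_le_add_left (abs_sub _ _) _)
    _ < ε := by linarith

end GaussianField

open GaussianField in
theorem lemma5p1 {n : ℕ} (D : Set (EuclideanSpace ℝ (Fin n))) (hD : IsCompact D)
    (h0 : (0 : EuclideanSpace ℝ (Fin n)) ∈ D)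
    -- the family of centered Gaussian fields on `D`, indexed by `u > 0`
    {Ω : ℝ → Type*} [∀ u, MeasurableSpace (Ω u)]
    (P : ∀ u, Measure (Ω u)) [∀ u, IsProbabilityMeasure (P u)]
    (ξ : ∀ u, D → Ω u → ℝ)
    (hξ : ∀ u, 0 < u → IsCenteredContinuous (ξ u) (P u))
    -- the limiting field and the limiting drift
    {Ω' : Type*} [MeasurableSpace Ω'] (Q : Measure Ω') [IsProbabilityMeasure Q]
    (η : EuclideanSpace ℝ (Fin n) → Ω' → ℝ)
    (hη : IsCenteredContinuous η Q) (hη0 : ∀ᵐ ω ∂Q, η 0 ω = 0)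
    (d : D → ℝ) (hd_meas : Measurable d) (hd_bdd : ∃ M : ℝ, ∀ t, |d t| ≤ M)
    -- condition C1
    (hC1_zero : ∀ᶠ u in atTop, stdDev (ξ u) (P u) ⟨0, h0⟩ = 1)
    (hC1 : TendstoUniformly (fun (u : ℝ) (t : D) => u ^ 2 * (1 - stdDev (ξ u) (P u) t)) d atTop)
    -- condition C2
    (hC2 : ∀ t s : D,
      Tendsto (fun u : ℝ => u ^ 2 * Var[fun ω => ξ u t ω - ξ u s ω; P u]) atTop
        (𝓝 (2 * Var[fun ω => η t ω - η s ω; Q])))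
    -- condition C3
    (hC3 : ∃ G > (0 : ℝ), ∃ ν > (0 : ℝ), ∃ u₀ > (0 : ℝ), ∀ u > u₀, ∀ t s : D,
      u ^ 2 * Var[fun ω => ξ u t ω - ξ u s ω; P u]
        ≤ G * ‖(t : EuclideanSpace ℝ (Fin n)) - s‖ ^ ν)
    -- the functional, with F1 and F2
    (F : C(D, ℝ) → ℝ) (hF : Continuous F)
    (hF1 : ∀ f : C(D, ℝ), |F f| ≤ ⨆ t : D, |f t|)
    (hF2 : ∀ (f : C(D, ℝ)) (c b : ℝ), 0 < c →
      F (c • f + ContinuousMap.const D b) = c * F f + b)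
    -- the threshold
    (g : ℝ → ℝ) (hg_pos : ∀ u, 0 < u → 0 < g u)
    (hg_meas : Measurable fun u : Set.Ioi (0 : ℝ) => g u)
    (a : ℝ) (ha : 0 < a) (hga : Tendsto (fun u => g u / u) atTop (𝓝 a)) :
    Integrable
        (expFunctional F (fun (t : D) ω => a * η t ω) (fun t => a ^ 2 * d t) Q) Q ∧
      0 < piterbargConst F (fun (t : D) ω => a * η t ω) (fun t => a ^ 2 * d t) Q ∧
      (fun u => (P u).real {ω | g u < pathEval F fun t => ξ u t ω}) ~[atTop]
        fun u => piterbargConst F (fun (t : D) ω => a * η t ω) (fun t => a ^ 2 * d t) Q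
          * normalTail (g u) := by
  obtain ⟨G, hG, ν, hν, u₀, -, hC3⟩ := hC3
  obtain ⟨M, hM⟩ := hd_bdd
  have : CompactSpace D := isCompact_iff_compactSpace.1 hD
  have : Nonempty D := ⟨⟨0, h0⟩⟩
  obtain ⟨N⟩ := nonempty_dyadicNets hD ⟨0, h0⟩
  have hF1' : ∀ f : C(D, ℝ), |F f| ≤ ‖f‖ := fun f => by
    rw [ContinuousMap.norm_eq_iSup_norm]
    exact hF1 f
  -- The bound g/u < 2a turns C3 into an increment bound at scale `g` with constant 4a²G.
  have hev : ∀ᶠ u : ℝ in atTop, 0 < u ∧ u₀ < u ∧ stdDev (ξ u) (P u) ⟨0, h0⟩ = 1 ∧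
      g u / u < 2 * a := by
    filter_upwards [eventually_gt_atTop 0, eventually_gt_atTop u₀, hC1_zero,
      hga.eventually (gt_mem_nhds (by linarith : a < 2 * a))] with u h1 h2 h3 h4
    exact ⟨h1, h2, h3, h4⟩
  have hlim : IsCenteredContinuous (fun (t : D) ω => a * η t ω) Q :=
    ⟨(hη.gaussian.restrict D).smul fun _ => a,
      fun t => by rw [integral_const_mul, hη.centered, mul_zero],
      hη.continuous_paths.mono fun ω hω => (hω.comp continuous_subtype_val).const_mul a⟩
  have hgtop : Tendsto g atTop atTop := by
    have h1 : Tendsto (fun u => g u / u * u) atTop atTop := hga.pos_mul_atTop ha tendsto_id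
    refine h1.congr' ?_
    filter_upwards [eventually_gt_atTop 0] with u hu
    field_simp
  have hlocal : ∀ v : ℕ → ℝ, Tendsto v atTop atTop →
      (∀ k, 0 < v k ∧ u₀ < v k ∧ stdDev (ξ (v k)) (P (v k)) ⟨0, h0⟩ = 1 ∧
        g (v k) / v k < 2 * a) →
      LocalStructure (⟨0, h0⟩ : D) (fun k => ξ (v k)) (fun k => P (v k))
        (fun (t : D) ω => a * η t ω) Q (fun t => a ^ 2 * d t) (fun k => g (v k))
        (4 * a ^ 2 * G) ν := by
    intro v hv hvk
    have hgv : Tendsto (fun k => g (v k) / v k) atTop (𝓝 a) := hga.comp hv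
    have hsplit : ∀ k x, g (v k) ^ 2 * x = (g (v k) / v k) ^ 2 * (v k ^ 2 * x) := by
      intro k x
      have := (hvk k).1
      field_simp
    refine ⟨fun k => hξ _ (hvk k).1, hlim, ?_, fun k => hg_pos _ (hvk k).1, hgtop.comp hv, hν,
      by positivity, fun k => ?_, ?_, fun s t => ?_, fun k s t => ?_⟩
    · filter_upwards [hη0] with ω hω
      simp [hω]
    · exact Real.sqrt_eq_one.1 (hvk k).2.2.1
    · have hu : TendstoUniformly
          (fun k t => v k ^ 2 * (1 - stdDev (ξ (v k)) (P (v k)) t)) d atTop := fun s hs =>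
        hv.eventually (hC1 s hs)
      have := tendstoUniformly_one_sub_sq hM hv (fun k => (hvk k).1) hgv hu
      simpa only [stdDev, Real.sq_sqrt (variance_nonneg _ _)] using this
    · simp_rw [hsplit, ← mul_sub]
      rw [variance_const_mul, mul_left_comm]
      exact (hgv.pow 2).mul ((hC2 s t).comp hv)
    · have hg2 : (g (v k) / v k) ^ 2 ≤ 4 * a ^ 2 := by
        have h1 : 0 < g (v k) / v k := div_pos (hg_pos _ (hvk k).1) (hvk k).1
        have h2 := (hvk k).2.2.2
        nlinarith
      rw [hsplit, mul_assoc (4 * a ^ 2), Subtype.dist_eq, dist_eq_norm]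
      exact mul_le_mul hg2 (hC3 _ (hvk k).2.1 s t)
        (mul_nonneg (sq_nonneg _) (variance_nonneg _ _)) (by positivity)
  have hratio : ∀ v : ℕ → ℝ, Tendsto v atTop atTop →
      (∀ k, 0 < v k ∧ u₀ < v k ∧ stdDev (ξ (v k)) (P (v k)) ⟨0, h0⟩ = 1 ∧
        g (v k) / v k < 2 * a) → _ := fun v hv hvk =>
    (hlocal v hv hvk).integrable_and_tendsto_ratio N hF hF1' hF2
  obtain ⟨U, hU⟩ := eventually_atTop.1 hev
  -- Integrability does not involve `u`, so any one admissible sequence yields it.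
  have hint := (hratio (fun k => U + k)
    (tendsto_atTop_add_const_left _ _ tendsto_natCast_atTop_atTop)
    fun k => hU _ (le_add_of_nonneg_right (Nat.cast_nonneg k))).1
  have hpos : 0 < piterbargConst F (fun (t : D) ω => a * η t ω) (fun t => a ^ 2 * d t) Q :=
    integral_exp_pos hint
  refine ⟨hint, hpos, ?_⟩
  set H := piterbargConst F (fun (t : D) ω => a * η t ω) (fun t => a ^ 2 * d t) Q with hH
  have htail : ∀ x, 0 < normalTail x := by
    intro x
    have hne : gaussianReal 0 1 (Set.Ioi x) ≠ 0 := fun h =>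
      (isOpen_Ioi.measure_pos volume Set.nonempty_Ioi).ne'
        (gaussianReal_absolutelyContinuous' 0 one_ne_zero h)
    exact ENNReal.toReal_pos hne (measure_ne_top _ _)
  rw [isEquivalent_iff_tendsto_one (Eventually.of_forall fun u => (mul_pos hpos (htail _)).ne')]
  -- The limit in `u` is tested along sequences; dropping the first `n₀` terms makes every eventual
  -- condition hold for all indices.
  refine tendsto_of_seq_tendsto fun v hv => ?_
  obtain ⟨n₀, hn₀⟩ := eventually_atTop.1 (hv.eventually hev)
  rw [← tendsto_add_atTop_iff_nat n₀]
  have hv' : Tendsto (fun k => v (k + n₀)) atTop atTop := (tendsto_add_atTop_iff_nat n₀).2 hv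
  have hvk := fun k => hn₀ (k + n₀) (Nat.le_add_left _ _)
  have h1 := (hratio (fun k => v (k + n₀)) hv' hvk).2
  have h2 := tendsto_normalTail_div (hgtop.comp hv') fun k => hg_pos _ (hvk k).1
  have h3 := h1.div (h2.const_mul H) (by simpa using hpos.ne')
  rw [mul_one, div_self hpos.ne'] at h3
  refine h3.congr fun k => ?_
  have hg := hg_pos _ (hvk k).1
  have hpdf := gaussianPDFReal_pos 0 1 (g (v (k + n₀))) one_ne_zero
  have ht := htail (g (v (k + n₀)))
  simp only [Function.comp_apply, Pi.div_apply]
  field_simp
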